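/- Let $n\ge 1$, $p>1$, $0<s<1$ and $a=p(1-s)-1$. Write points of $\mathbf{R}^{n+1}=\mathbf{R}^n\times\mathbf{R}$ as $z=(x,t)$ and let $d\mu_a=|t|^a\,dx\,dt$. All balls are Euclidean and $B(\cdot,\rho)$ denotes an open ball, in $\mathbf{R}^n$ or $\mathbf{R}^{n+1}$ according to its centre; $C_0^\infty(B)$ is the set of smooth real functions with compact support contained in $B$. For a ball $B\subset\mathbf{R}^n$ and a compact set $K\subset B$ let $$\operatorname{cap}_{B^s_p}(K,B)=\inf\Bigl\{\int_{\mathbf{R}^n}\int_{\mathbf{R}^n}\frac{|v(x)-v(y)|^p}{|x-y|^{n+sp}}\,dx\,dy : v\in C_0^\infty(B),\ v\ge 1\text{ on }K\Bigr\},$$ and for a ball $B\subset\mathbf{R}^{n+1}$ and a compact set $K\subset B$ let $$\operatorname{cap}_{p,|t|^a}(K,B)=\inf\Bigl\{\int_{B}|\nabla v|^p\,d\mu_a : v\in C_0^\infty(B),\ v\ge 1\text{ on }K\Bigr\}.$$ For a Borel set $E\subset B$, each of the two capacities is defined as the supremum of its values on the compact subsets of $E$: $$\operatorname{cap}(E,B)=\sup_{K\subset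 E,\ K\text{ compact}}\operatorname{cap}(K,B).$$ Then there is a constant $C>0$, depending only on $n$, $p$ and $s$, such that for all $x_0\in\mathbf{R}^n$, all $r>0$ and all Borel sets $E\subset\overline{B(x_0,r)}\subset\mathbf{R}^n$, with $z_0=(x_0,0)$, $$\tfrac1C\operatorname{cap}_{p,|t|^a}\bigl(E\times\{0\},B(z_0,2r)\bigr)\le\operatorname{cap}_{B^s_p}\bigl(E,B(x_0,2r)\bigr)\le C\operatorname{cap}_{p,|t|^a}\bigl(E\times\{0\},B(z_0,2r)\bigr).$$ -/

import Mathlib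

open MeasureTheory Metric
open scoped ENNReal ContDiff Gradient

noncomputable section

/-- `ℝⁿ` with its Euclidean norm and Lebesgue measure. -/
abbrev Rn (n : ℕ) : Type := EuclideanSpace ℝ (Fin n)

/-- `ℝⁿ⁺¹ = ℝⁿ × ℝ`, with points `z = (x, t)`, the Euclidean norm `√(|x|² + t²)` and
Lebesgue measure. -/
abbrev RnR (n : ℕ) : Type := WithLp 2 (Rn n × ℝ)

/-- The point `(x, t)` of `ℝⁿ⁺¹`. -/
def mkPt {n : ℕ} (x : Rn n) (t : ℝ) : RnR n := WithLp.toLp 2 (x, t)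

/-- `v ∈ C₀^∞(B)`: smooth, with compact support contained in `B`. -/
structure IsTestFunctionOn {V : Type*} [NormedAddCommGroup V] [NormedSpace ℝ V]
    (v : V → ℝ) (B : Set V) : Prop where
  smooth : ContDiff ℝ ∞ v
  hasCompactSupport : HasCompactSupport v
  tsupport_subset : tsupport v ⊆ B

/-- The `p`-th power of the Besov seminorm,
`∫∫ |v(x) - v(y)|^p / |x - y|^(n + s p) dx dy`, as an extended nonnegative number. -/
def besovEnergy {n : ℕ} (p s : ℝ) (v : Rn n → ℝ) : ℝ≥0∞ :=
  ∫⁻ y, ∫⁻ x, ENNReal.ofReal (|v x - v y| ^ p / ‖x - y‖ ^ ((n : ℝ) + s * p))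

/-- The condenser Besov capacity of a compact set `K` with respect to `B`: the infimum of
`besovEnergy p s v` over all `v ∈ C₀^∞(B)` with `v ≥ 1` on `K`. -/
def besovCapCompact {n : ℕ} (p s : ℝ) (K B : Set (Rn n)) : ℝ≥0∞ :=
  ⨅ (v : Rn n → ℝ) (_ : IsTestFunctionOn v B ∧ ∀ x ∈ K, 1 ≤ v x), besovEnergy p s v

/-- The condenser Besov capacity of a Borel set `E` with respect to `B`: the supremum of the
capacities of the compact subsets of `E`. -/
def besovCap {n : ℕ} (p s : ℝ) (E B : Set (Rn n)) : ℝ≥0∞ :=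
  ⨆ (K : Set (Rn n)) (_ : IsCompact K ∧ K ⊆ E), besovCapCompact p s K B

/-- The measure `dμ_a = |t|^a dx dt` on `ℝⁿ⁺¹`. -/
def weightedMeasure (n : ℕ) (a : ℝ) : Measure (RnR n) :=
  (volume : Measure (RnR n)).withDensity fun z => ENNReal.ofReal (|z.snd| ^ a)

/-- The weighted condenser capacity of a compact set `K` with respect to `B`: the infimum of
`∫_B |∇v|^p dμ_a` over all `v ∈ C₀^∞(B)` with `v ≥ 1` on `K`. -/
def weightedCapCompact {n : ℕ} (p a : ℝ) (K B : Set (RnR n)) : ℝ≥0∞ :=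
  ⨅ (v : RnR n → ℝ) (_ : IsTestFunctionOn v B ∧ ∀ z ∈ K, 1 ≤ v z),
    ∫⁻ z in B, ENNReal.ofReal (‖∇ v z‖ ^ p) ∂(weightedMeasure n a)

/-- The weighted condenser capacity of a Borel set `E` with respect to `B`: the supremum of the
capacities of the compact subsets of `E`. -/
def weightedCap {n : ℕ} (p a : ℝ) (E B : Set (RnR n)) : ℝ≥0∞ :=
  ⨆ (K : Set (RnR n)) (_ : IsCompact K ∧ K ⊆ E), weightedCapCompact p a K B

end

/-!
Both capacities are infima over smooth test functions, and a compact subset of `E × {0}` is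
`K × {0}` with `K ⊆ E` compact. It is therefore enough to pass, with control of the energies, from a
test function in `ℝⁿ⁺¹` to one in `ℝⁿ` and back. With `a = p (1 - s) - 1` this is the trace and
extension theory of the weighted Sobolev space, in a form that applies to smooth functions only.

*Trace* (`exists_besovEnergy_trace_le`). Given `v` on `ℝⁿ⁺¹`, put `u(x) = v(x, 0)`. The points
`(x, 0)` and `(y, 0)` are joined through the elevated midpoint `((x + y) / 2, |x - y|)`. On each of
the two segments the increment of `v` is an integral over `θ ∈ (0, 1)` of `|∇v|` at the point
`(x + θ h / 2, θ |h|)`, where `h = y - x`. Hölder's inequality with a weight `θ^b` bounds its `p`-th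
power by an integral of `θ^(b p) |∇v|^p`. Integrating first in `x`, then in `h` (dilation by `θ`
and polar coordinates) and last in `θ` gives `∫ |∇v|^p dμ_a`; the two integrals in `θ` converge for
`b = 1 - 1 / p - s / 2`. No support condition enters.

*Extension* (`exists_testFunction_extension`). Given `u`, put `V(x, t) = ∫ u(x - t y) φ(y) dy` with
a fixed bump function `φ` of integral one. This is smooth on all of `ℝⁿ⁺¹`, including `t = 0`, and
`V(x, 0) = u(x)`. Integration by parts in `y` gives
`|∇V(x, t)| ≤ (M / |t|) ∫_{|y| ≤ 1} |u(x - t y) - u(x)| dy`, and then Jensen's inequality, the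
substitution `h = t y` and the integral of `|t|^(-n - s p - 1)` over `|t| ≥ |h|` produce the Besov
kernel `|h|^(-n - s p)`. The function `V` is multiplied by a cutoff at scale `r`; the additional
term is controlled by `r^(-p) r^(a + 1) ∫ |u|^p`, where `a + 1 - p = -s p`, and the Poincaré
inequality `∫ |u|^p ≤ C r^(s p) [u]^p` (`exists_lintegral_rpow_le_besovEnergy`) finishes the
estimate with a constant that does not depend on `r`.
-/

section

variable {n : ℕ}

/-! ### Integration lemmas -/

/-- Polar coordinates for the integral of a radial function with values in `[0, ∞]`. -/
theorem lintegral_fun_norm_addHaar {E : Type*} [NormedAddCommGroup E] [NormedSpace ℝ E]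
    [MeasurableSpace E] [BorelSpace E] [FiniteDimensional ℝ E] [Nontrivial E]
    (μ : Measure E) [μ.IsAddHaarMeasure] {f : ℝ → ℝ≥0∞} (hf : Measurable f) :
    ∫⁻ x, f ‖x‖ ∂μ = μ.toSphere Set.univ *
      ∫⁻ ρ in Set.Ioi (0 : ℝ), ENNReal.ofReal (ρ ^ (Module.finrank ℝ E - 1)) * f ρ := by
  have h1 : ∫⁻ x, f ‖x‖ ∂μ = ∫⁻ x : ({(0 : E)}ᶜ : Set E), f ‖x.1‖ ∂(μ.comap (↑)) := by
    rw [lintegral_subtype_comap (measurableSet_singleton _).compl (fun x ↦ f ‖x‖),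
      restrict_compl_singleton]
  have h2 : ∫⁻ x : ({(0 : E)}ᶜ : Set E), f ‖x.1‖ ∂(μ.comap (↑)) =
      ∫⁻ x, f x.2 ∂μ.toSphere.prod (.volumeIoiPow (Module.finrank ℝ E - 1)) := by
    have := μ.measurePreserving_homeomorphUnitSphereProd.lintegral_comp
      (f := fun x => f x.2) (by fun_prop)
    simpa using this
  rw [h1, h2, lintegral_prod _ (by fun_prop)]
  dsimp only
  rw [lintegral_const, mul_comm, Measure.volumeIoiPow,
    lintegral_withDensity_eq_lintegral_mul _ (by fun_prop) (by fun_prop)]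
  congr 1
  exact lintegral_subtype_comap measurableSet_Ioi
    (fun ρ : ℝ => ENNReal.ofReal (ρ ^ (Module.finrank ℝ E - 1)) * f ρ)

theorem lintegral_comp_smul_addHaar {E : Type*} [NormedAddCommGroup E] [NormedSpace ℝ E]
    [MeasurableSpace E] [BorelSpace E] [FiniteDimensional ℝ E]
    (μ : Measure E) [μ.IsAddHaarMeasure] {f : E → ℝ≥0∞} (hf : Measurable f) {R : ℝ}
    (hR : R ≠ 0) :
    ∫⁻ x, f (R • x) ∂μ = ENNReal.ofReal |(R ^ Module.finrank ℝ E)⁻¹| * ∫⁻ x, f x ∂μ := by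
  rw [← lintegral_map hf (measurable_const_smul R), Measure.map_addHaar_smul μ hR,
    lintegral_smul_measure, smul_eq_mul]

/-- Hölder's inequality raised to the power `p`. -/
theorem lintegral_mul_rpow_le {α : Type*} [MeasurableSpace α] (μ : Measure α) {p : ℝ}
    (hp : 1 < p) {f g : α → ℝ≥0∞} (hf : AEMeasurable f μ) (hg : AEMeasurable g μ) :
    (∫⁻ a, f a * g a ∂μ) ^ p ≤
      (∫⁻ a, g a ^ (p / (p - 1)) ∂μ) ^ (p - 1) * ∫⁻ a, f a ^ p ∂μ := by
  have hpq : p.HolderConjugate (p / (p - 1)) := Real.HolderConjugate.conjExponent hp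
  have h := ENNReal.rpow_le_rpow (ENNReal.lintegral_mul_le_Lp_mul_Lq μ hpq hf hg)
    (show 0 ≤ p by linarith)
  rw [ENNReal.mul_rpow_of_nonneg _ _ (by linarith), ← ENNReal.rpow_mul, ← ENNReal.rpow_mul,
    one_div_mul_cancel (by linarith : p ≠ 0), ENNReal.rpow_one] at h
  have he : 1 / (p / (p - 1)) * p = p - 1 := by
    rw [one_div_div, div_mul_cancel₀ _ (by linarith)]
  rw [he] at h
  exact h.trans (mul_comm _ _).le

/-- Jensen's inequality for `t ↦ t ^ p` on a set, without normalization of the measure. -/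
theorem setLIntegral_rpow_le {α : Type*} [MeasurableSpace α] (μ : Measure α) {p : ℝ}
    (hp : 1 < p) (S : Set α) {f : α → ℝ≥0∞} (hf : AEMeasurable f (μ.restrict S)) :
    (∫⁻ a in S, f a ∂μ) ^ p ≤ μ S ^ (p - 1) * ∫⁻ a in S, f a ^ p ∂μ := by
  simpa using lintegral_mul_rpow_le (μ.restrict S) hp hf (g := fun _ => 1) (by fun_prop)

theorem setLIntegral_Ioo_rpow {c R : ℝ} (hc : -1 < c) (hR : 0 < R) :
    ∫⁻ t in Set.Ioo 0 R, ENNReal.ofReal (t ^ c) = ENNReal.ofReal (R ^ (c + 1) / (c + 1)) := by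
  rw [← ofReal_integral_eq_lintegral_ofReal]
  · rw [← integral_Ioc_eq_integral_Ioo, ← intervalIntegral.integral_of_le hR.le,
      integral_rpow (Or.inl hc), Real.zero_rpow (by linarith), sub_zero]
  · exact (intervalIntegral.integrableOn_Ioo_rpow_iff hR).2 hc
  · filter_upwards [ae_restrict_mem measurableSet_Ioo] with t ht using Real.rpow_nonneg ht.1.le _

theorem setLIntegral_Ioi_rpow {c R : ℝ} (hc : c < -1) (hR : 0 < R) :
    ∫⁻ t in Set.Ioi R, ENNReal.ofReal (t ^ c) = ENNReal.ofReal (-R ^ (c + 1) / (c + 1)) := by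
  rw [← ofReal_integral_eq_lintegral_ofReal, integral_Ioi_rpow_of_lt hc hR]
  · exact integrableOn_Ioi_rpow_of_lt hc hR
  · filter_upwards [ae_restrict_mem measurableSet_Ioi] with t ht using
      Real.rpow_nonneg (hR.le.trans (le_of_lt ht)) _

theorem lintegral_fun_abs {f : ℝ → ℝ≥0∞} (hf : Measurable f) :
    ∫⁻ t : ℝ, f |t| = 2 * ∫⁻ t in Set.Ioi (0 : ℝ), f t := by
  have h := lintegral_fun_norm_addHaar (volume : Measure ℝ) hf
  have h2 : (volume : Measure ℝ).toSphere Set.univ = 2 := by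
    rw [Measure.toSphere_apply_univ]; simp [Real.volume_ball]
  simpa [h2] using h


theorem measurable_mkPt : Measurable fun q : Rn n × ℝ => mkPt q.1 q.2 :=
  WithLp.measurable_toLp 2 _

theorem continuous_mkPt : Continuous fun q : Rn n × ℝ => mkPt q.1 q.2 :=
  WithLp.prod_continuous_toLp 2 _ _

/-- Tonelli's theorem on `ℝⁿ⁺¹ = ℝⁿ × ℝ`. -/
theorem lintegral_RnR {F : RnR n → ℝ≥0∞} (hF : Measurable F) :
    ∫⁻ z, F z = ∫⁻ t, ∫⁻ x, F (mkPt x t) := by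
  rw [← (WithLp.volume_preserving_toLp (Rn n) ℝ).lintegral_comp hF, Measure.volume_eq_prod,
    lintegral_prod_symm (fun q : Rn n × ℝ => F (WithLp.toLp 2 q))
      (hF.comp (WithLp.measurable_toLp 2 _)).aemeasurable]
  rfl

theorem lintegral_weightedMeasure {F : RnR n → ℝ≥0∞} (hF : Measurable F) (a : ℝ) :
    ∫⁻ z, F z ∂(weightedMeasure n a) =
      ∫⁻ t, ENNReal.ofReal (|t| ^ a) * ∫⁻ x, F (mkPt x t) := by
  have hw : Measurable fun z : RnR n => ENNReal.ofReal (|z.snd| ^ a) := by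
    have : Measurable fun z : RnR n => z.snd := by fun_prop
    fun_prop
  rw [weightedMeasure, lintegral_withDensity_eq_lintegral_mul _ hw hF,
    lintegral_RnR (hw.mul hF)]
  refine lintegral_congr fun t => ?_
  rw [← lintegral_const_mul]
  · rfl
  · exact hF.comp (measurable_mkPt.comp measurable_prodMk_right)

theorem ofReal_norm_gradient_rpow {V : Type*} [NormedAddCommGroup V] [InnerProductSpace ℝ V]
    [CompleteSpace V] (v : V → ℝ) (z : V) {p : ℝ} (hp : 0 ≤ p) :
    ENNReal.ofReal (‖∇ v z‖ ^ p) = ‖fderiv ℝ v z‖ₑ ^ p := by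
  rw [← ENNReal.ofReal_rpow_of_nonneg (norm_nonneg _) hp, ofReal_norm, gradient,
    ← ofReal_norm, LinearIsometryEquiv.norm_map, ofReal_norm]

/-! ### The Besov energy in terms of increments -/

/-- The kernel `|h|^(-(n + s p))` of the Besov energy, with value `0` at `h = 0`. -/
noncomputable def besovKernel (n : ℕ) (p s : ℝ) (h : Rn n) : ℝ≥0∞ :=
  ENNReal.ofReal (‖h‖ ^ (-((n : ℝ) + s * p)))

theorem measurable_besovKernel (p s : ℝ) : Measurable (besovKernel n p s) := by
  unfold besovKernel; fun_prop

theorem besovKernel_neg (p s : ℝ) (h : Rn n) : besovKernel n p s (-h) = besovKernel n p s h := by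
  simp [besovKernel]

theorem besovEnergy_eq {p s : ℝ} (hp : 0 ≤ p) (u : Rn n → ℝ) :
    besovEnergy p s u = ∫⁻ y, ∫⁻ x, ‖u x - u y‖ₑ ^ p * besovKernel n p s (x - y) := by
  refine lintegral_congr fun y => lintegral_congr fun x => ?_
  rw [besovKernel, Real.rpow_neg (norm_nonneg _), div_eq_mul_inv,
    ENNReal.ofReal_mul (by positivity), ← ENNReal.ofReal_rpow_of_nonneg (abs_nonneg _) hp,
    ← Real.norm_eq_abs, ofReal_norm]

/-- The Besov energy as an integral over increments. -/
theorem besovEnergy_eq_increments {p s : ℝ} (hp : 0 ≤ p) {u : Rn n → ℝ} (hu : Measurable u) :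
    besovEnergy p s u = ∫⁻ h, (∫⁻ x, ‖u (x - h) - u x‖ₑ ^ p) * besovKernel n p s h := by
  have hk := measurable_besovKernel (n := n) p s
  have h1 : ∀ y, ∫⁻ x, ‖u x - u y‖ₑ ^ p * besovKernel n p s (x - y) =
      ∫⁻ h, ‖u (y - h) - u y‖ₑ ^ p * besovKernel n p s h := fun y => by
    rw [← lintegral_sub_left_eq_self (fun x => ‖u x - u y‖ₑ ^ p * besovKernel n p s (x - y)) y]
    simp [besovKernel_neg]
  rw [besovEnergy_eq hp, lintegral_congr h1, lintegral_lintegral_swap (by fun_prop)]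
  refine lintegral_congr fun h => ?_
  rw [lintegral_mul_const _ (by fun_prop)]

/-! ### The trace inequality -/

theorem hasDerivAt_add_smul_const {V : Type*} [NormedAddCommGroup V] [NormedSpace ℝ V]
    (z d : V) (θ : ℝ) : HasDerivAt (fun θ : ℝ => z + θ • d) d θ := by
  simpa using ((hasDerivAt_id θ).smul_const d).const_add z

theorem enorm_sub_le_setLIntegral_fderiv {V : Type*} [NormedAddCommGroup V] [NormedSpace ℝ V]
    {v : V → ℝ} (hv : ContDiff ℝ 1 v) (z d : V) :
    ‖v z - v (z + d)‖ₑ ≤ ∫⁻ θ in Set.Ioo (0 : ℝ) 1, ‖fderiv ℝ v (z + θ • d)‖ₑ * ‖d‖ₑ := by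
  have hc : Continuous fun θ : ℝ => fderiv ℝ v (z + θ • d) d :=
    ((hv.continuous_fderiv (by simp)).comp (by fun_prop)).clm_apply continuous_const
  have hd : ∀ θ : ℝ, HasDerivAt (fun θ : ℝ => v (z + θ • d)) (fderiv ℝ v (z + θ • d) d) θ := by
    intro θ
    exact ((hv.differentiable (by simp)).differentiableAt.hasFDerivAt).comp_hasDerivAt θ
      (hasDerivAt_add_smul_const z d θ)
  have h := intervalIntegral.integral_eq_sub_of_hasDerivAt (fun θ _ => hd θ)
    (hc.intervalIntegrable 0 1)
  simp only [one_smul, zero_smul, add_zero] at h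
  rw [← enorm_neg, neg_sub, ← h, intervalIntegral.integral_of_le zero_le_one,
    integral_Ioc_eq_integral_Ioo]
  refine (enorm_integral_le_lintegral_enorm _).trans (lintegral_mono fun θ => ?_)
  exact (fderiv ℝ v (z + θ • d)).le_opENorm d

/-- Hölder's inequality on `(0, 1)` against the weight `θ^b`; the `q`-th power of `θ^(-b)`, with
`q = p / (p - 1)` the conjugate exponent, is integrable because `b q < 1`. -/
theorem exists_setLIntegral_Ioo_rpow_le {p b : ℝ} (hp : 1 < p) (hb : b * (p / (p - 1)) < 1) :
    ∃ C : ℝ≥0∞, C ≠ ⊤ ∧ ∀ F : ℝ → ℝ≥0∞, Measurable F →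
      (∫⁻ θ in Set.Ioo (0 : ℝ) 1, F θ) ^ p ≤
        C * ∫⁻ θ in Set.Ioo (0 : ℝ) 1, F θ ^ p * ENNReal.ofReal (θ ^ (b * p)) := by
  refine ⟨(∫⁻ θ in Set.Ioo (0 : ℝ) 1, ENNReal.ofReal (θ ^ (-b)) ^ (p / (p - 1))) ^ (p - 1),
    ENNReal.rpow_ne_top_of_nonneg (by linarith) ?_, fun F hF => ?_⟩
  · have : ∫⁻ θ in Set.Ioo (0 : ℝ) 1, ENNReal.ofReal (θ ^ (-b)) ^ (p / (p - 1)) =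
        ∫⁻ θ in Set.Ioo (0 : ℝ) 1, ENNReal.ofReal (θ ^ (-b * (p / (p - 1)))) := by
      refine setLIntegral_congr_fun measurableSet_Ioo fun θ hθ => ?_
      rw [ENNReal.ofReal_rpow_of_pos (Real.rpow_pos_of_pos hθ.1 _), ← Real.rpow_mul hθ.1.le]
    rw [this, setLIntegral_Ioo_rpow (by linarith) one_pos]
    exact ENNReal.ofReal_ne_top
  · have h1 : ∫⁻ θ in Set.Ioo (0 : ℝ) 1, F θ = ∫⁻ θ in Set.Ioo (0 : ℝ) 1,
        (F θ * ENNReal.ofReal (θ ^ b)) * ENNReal.ofReal (θ ^ (-b)) := by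
      refine setLIntegral_congr_fun measurableSet_Ioo fun θ hθ => ?_
      rw [mul_assoc, ← ENNReal.ofReal_mul (Real.rpow_nonneg hθ.1.le _), ← Real.rpow_add hθ.1]
      simp
    have h2 : ∫⁻ θ in Set.Ioo (0 : ℝ) 1, F θ ^ p * ENNReal.ofReal (θ ^ (b * p)) =
        ∫⁻ θ in Set.Ioo (0 : ℝ) 1, (F θ * ENNReal.ofReal (θ ^ b)) ^ p := by
      refine setLIntegral_congr_fun measurableSet_Ioo fun θ hθ => ?_
      rw [ENNReal.mul_rpow_of_nonneg _ _ (by linarith),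
        ENNReal.ofReal_rpow_of_pos (Real.rpow_pos_of_pos hθ.1 _), ← Real.rpow_mul hθ.1.le]
    rw [h1, h2]
    exact lintegral_mul_rpow_le _ hp (by fun_prop) (by fun_prop)


/-- Integrating a function of `|h|` against `|h|^(a + 1 - n)` over `ℝⁿ` produces the weight
`|t|^a` on the line; the dilation by `θ` costs the power `θ^(-(a + 1))`. -/
theorem exists_lintegral_dilate_le (hn : 1 ≤ n) (a : ℝ) :
    ∃ C : ℝ≥0∞, C ≠ ⊤ ∧ ∀ G : ℝ → ℝ≥0∞, Measurable G → ∀ θ : ℝ, 0 < θ →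
      ∫⁻ h : Rn n, ENNReal.ofReal (‖h‖ ^ (a + 1 - n)) * G (θ * ‖h‖) ≤
        C * (ENNReal.ofReal (θ ^ (-(a + 1))) * ∫⁻ t : ℝ, ENNReal.ofReal (|t| ^ a) * G t) := by
  have : NeZero n := ⟨by omega⟩
  have : Nontrivial (Rn n) := inferInstance
  refine ⟨(volume : Measure (Rn n)).toSphere Set.univ, measure_ne_top _ _, fun G hG θ hθ => ?_⟩
  have h1 : ∀ h : Rn n, ENNReal.ofReal (‖h‖ ^ (a + 1 - n)) * G (θ * ‖h‖) =
      ENNReal.ofReal ((θ⁻¹) ^ (a + 1 - n)) *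
        (ENNReal.ofReal (‖θ • h‖ ^ (a + 1 - n)) * G ‖θ • h‖) := fun h => by
    rw [← mul_assoc, ← ENNReal.ofReal_mul (by positivity),
      ← Real.mul_rpow (by positivity) (by positivity), norm_smul, Real.norm_of_nonneg hθ.le,
      inv_mul_cancel_left₀ hθ.ne']
  rw [lintegral_congr h1, lintegral_const_mul _ (by fun_prop),
    lintegral_comp_smul_addHaar volume
      (f := fun h : Rn n => ENNReal.ofReal (‖h‖ ^ (a + 1 - n)) * G ‖h‖) (by fun_prop) hθ.ne',
    lintegral_fun_norm_addHaar volume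
      (f := fun ρ : ℝ => ENNReal.ofReal (ρ ^ (a + 1 - n)) * G ρ) (by fun_prop),
    ← mul_assoc, finrank_euclideanSpace_fin, ← ENNReal.ofReal_mul (by positivity), mul_left_comm]
  have h2 : (θ⁻¹) ^ (a + 1 - n) * |(θ ^ n)⁻¹| = θ ^ (-(a + 1)) := by
    rw [abs_of_pos (by positivity), ← Real.rpow_natCast, Real.inv_rpow hθ.le,
      ← Real.rpow_neg hθ.le, ← Real.rpow_neg hθ.le, ← Real.rpow_add hθ]
    congr 1; ring
  rw [h2]
  refine mul_le_mul_right (mul_le_mul_right ?_ _) _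
  refine le_trans (le_of_eq ?_) (setLIntegral_le_lintegral (Set.Ioi (0 : ℝ)) _)
  refine setLIntegral_congr_fun measurableSet_Ioi fun ρ (hρ : 0 < ρ) => ?_
  rw [← mul_assoc, ← ENNReal.ofReal_mul (by positivity), ← Real.rpow_natCast,
    ← Real.rpow_add hρ, abs_of_pos hρ, Nat.cast_sub hn]
  congr 3
  push_cast; ring

theorem enorm_mkPt_le (h : Rn n) : ‖mkPt ((1 / 2 : ℝ) • h) ‖h‖‖ₑ ≤ 2 * ‖h‖ₑ := by
  have : ‖mkPt ((1 / 2 : ℝ) • h) ‖h‖‖ ≤ 2 * ‖h‖ := by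
    rw [WithLp.prod_norm_eq_of_L2]
    refine Real.sqrt_le_iff.2 ⟨by positivity, ?_⟩
    have h1 : ‖(mkPt ((1 / 2 : ℝ) • h) ‖h‖).fst‖ = 1 / 2 * ‖h‖ := by
      change ‖(1 / 2 : ℝ) • h‖ = _
      rw [norm_smul]; norm_num
    have h2 : ‖(mkPt ((1 / 2 : ℝ) • h) ‖h‖).snd‖ = ‖h‖ := norm_norm h
    rw [h1, h2]
    nlinarith [sq_nonneg ‖h‖]
  have h2 : (2 : ℝ≥0∞) * ENNReal.ofReal ‖h‖ = ENNReal.ofReal (2 * ‖h‖) := by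
    rw [ENNReal.ofReal_mul (by norm_num)]; simp
  rw [← ofReal_norm, ← ofReal_norm, h2]
  exact ENNReal.ofReal_le_ofReal this

/-- The increment of `v` from `(x, 0)` to the elevated midpoint `(x + h / 2, |h|)`, raised to the
power `p`, is at most a weighted integral of `|∇v|^p` along the segment. -/
theorem exists_midpoint_increment_le {p s b : ℝ} (hp : 1 < p) (hb : b * (p / (p - 1)) < 1) :
    ∃ C : ℝ≥0∞, C ≠ ⊤ ∧ ∀ v : RnR n → ℝ, ContDiff ℝ 1 v → ∀ h x : Rn n,
      ‖v (mkPt x 0) - v (mkPt (x + (1 / 2 : ℝ) • h) ‖h‖)‖ₑ ^ p * besovKernel n p s h ≤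
      C * ∫⁻ θ in Set.Ioo (0 : ℝ) 1, ENNReal.ofReal (θ ^ (b * p)) *
        (ENNReal.ofReal (‖h‖ ^ (p * (1 - s) - n)) *
          ‖fderiv ℝ v (mkPt (x + θ • (1 / 2 : ℝ) • h) (θ * ‖h‖))‖ₑ ^ p) := by
  have hp0 : 0 < p := by linarith
  obtain ⟨C₁, hC₁, h₁⟩ := exists_setLIntegral_Ioo_rpow_le hp hb
  refine ⟨C₁ * 2 ^ p, by finiteness, fun v hv h x => ?_⟩
  set F : ℝ → ℝ≥0∞ := fun θ => ‖fderiv ℝ v (mkPt (x + θ • (1 / 2 : ℝ) • h) (θ * ‖h‖))‖ₑ with hF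
  have hFm : Measurable F := ((hv.continuous_fderiv (by simp)).comp (continuous_mkPt.comp
    (by fun_prop : Continuous fun θ : ℝ => (x + θ • (1 / 2 : ℝ) • h, θ * ‖h‖)))).enorm.measurable
  have hz : ∀ θ : ℝ, mkPt x 0 + θ • mkPt ((1 / 2 : ℝ) • h) ‖h‖ =
      mkPt (x + θ • (1 / 2 : ℝ) • h) (θ * ‖h‖) := by
    intro θ
    simp [mkPt, ← WithLp.toLp_add, ← WithLp.toLp_smul]
  have e1 : ‖v (mkPt x 0) - v (mkPt (x + (1 / 2 : ℝ) • h) ‖h‖)‖ₑ ≤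
      ∫⁻ θ in Set.Ioo (0 : ℝ) 1, F θ * (2 * ‖h‖ₑ) := by
    have e1 := enorm_sub_le_setLIntegral_fderiv hv (mkPt x 0) (mkPt ((1 / 2 : ℝ) • h) ‖h‖)
    have e2 : mkPt x 0 + mkPt ((1 / 2 : ℝ) • h) ‖h‖ = mkPt (x + (1 / 2 : ℝ) • h) ‖h‖ := by
      simpa using hz 1
    rw [e2] at e1
    refine e1.trans (lintegral_mono fun θ => ?_)
    rw [hz]
    exact mul_le_mul_right (enorm_mkPt_le h) _
  have e3 : ‖h‖ₑ ^ p * besovKernel n p s h ≤ ENNReal.ofReal (‖h‖ ^ (p * (1 - s) - n)) := by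
    rcases eq_or_ne h 0 with rfl | h0
    · simp [ENNReal.zero_rpow_of_pos hp0]
    · have : 0 < ‖h‖ := norm_pos_iff.2 h0
      rw [besovKernel, ← ofReal_norm, ENNReal.ofReal_rpow_of_pos this,
        ← ENNReal.ofReal_mul (by positivity), ← Real.rpow_add this]
      apply le_of_eq
      congr 2
      ring
  calc ‖v (mkPt x 0) - v (mkPt (x + (1 / 2 : ℝ) • h) ‖h‖)‖ₑ ^ p * besovKernel n p s h
      ≤ (C₁ * ∫⁻ θ in Set.Ioo (0 : ℝ) 1, (F θ * (2 * ‖h‖ₑ)) ^ p *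
          ENNReal.ofReal (θ ^ (b * p))) * besovKernel n p s h := by
        gcongr
        exact (ENNReal.rpow_le_rpow e1 hp0.le).trans (h₁ _ (by fun_prop))
    _ = C₁ * ∫⁻ θ in Set.Ioo (0 : ℝ) 1, 2 ^ p * (ENNReal.ofReal (θ ^ (b * p)) *
          ((‖h‖ₑ ^ p * besovKernel n p s h) * F θ ^ p)) := by
        rw [mul_assoc, ← lintegral_mul_const _ (by fun_prop)]
        congr 1
        refine lintegral_congr fun θ => ?_
        rw [ENNReal.mul_rpow_of_nonneg _ _ hp0.le, ENNReal.mul_rpow_of_nonneg _ _ hp0.le]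
        ring
    _ = C₁ * 2 ^ p * ∫⁻ θ in Set.Ioo (0 : ℝ) 1, ENNReal.ofReal (θ ^ (b * p)) *
          ((‖h‖ₑ ^ p * besovKernel n p s h) * F θ ^ p) := by
        rw [lintegral_const_mul _ (by fun_prop), mul_assoc]
    _ ≤ _ := by gcongr

/-- Tonelli along the segments from `(x, 0)` to `(x + h / 2, |h|)`: the integral in `x` removes the
horizontal shift, the one in `h` produces the weight `|t|^a`, and the remaining power
`θ^(c - a - 1)` is integrable at `0` because `a < c`. -/
theorem exists_lintegral_segments_le (hn : 1 ≤ n) {a c : ℝ} (hc : a < c) :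
    ∃ C : ℝ≥0∞, C ≠ ⊤ ∧ ∀ g : Rn n × ℝ → ℝ≥0∞, Measurable g →
      ∫⁻ h : Rn n, ∫⁻ x : Rn n, ∫⁻ θ in Set.Ioo (0 : ℝ) 1, ENNReal.ofReal (θ ^ c) *
        (ENNReal.ofReal (‖h‖ ^ (a + 1 - n)) * g (x + θ • (1 / 2 : ℝ) • h, θ * ‖h‖)) ≤
      C * ∫⁻ t : ℝ, ENNReal.ofReal (|t| ^ a) * ∫⁻ x, g (x, t) := by
  obtain ⟨C₂, hC₂, h₂⟩ := exists_lintegral_dilate_le hn a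
  set C₃ : ℝ≥0∞ := ∫⁻ θ in Set.Ioo (0 : ℝ) 1, ENNReal.ofReal (θ ^ (c - (a + 1))) with hC₃
  have hC₃' : C₃ ≠ ⊤ := by
    rw [hC₃, setLIntegral_Ioo_rpow (by linarith) one_pos]
    exact ENNReal.ofReal_ne_top
  refine ⟨C₂ * C₃, by finiteness, fun g hg => ?_⟩
  set G : ℝ → ℝ≥0∞ := fun t => ∫⁻ x, g (x, t) with hG
  have hGm : Measurable G := hg.lintegral_prod_left'
  set Φ : Rn n → Rn n → ℝ → ℝ≥0∞ := fun h x θ => ENNReal.ofReal (θ ^ c) *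
    (ENNReal.ofReal (‖h‖ ^ (a + 1 - n)) * g (x + θ • (1 / 2 : ℝ) • h, θ * ‖h‖)) with hΦ
  have hΦm : Measurable fun q : (Rn n × Rn n) × ℝ => Φ q.1.1 q.1.2 q.2 := by
    simp only [hΦ]; fun_prop
  calc ∫⁻ h : Rn n, ∫⁻ x : Rn n, ∫⁻ θ in Set.Ioo (0 : ℝ) 1, Φ h x θ
      = ∫⁻ h : Rn n, ∫⁻ θ in Set.Ioo (0 : ℝ) 1, ∫⁻ x : Rn n, Φ h x θ := by
        refine lintegral_congr fun h => lintegral_lintegral_swap ?_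
        exact (hΦm.comp (show Measurable fun q : Rn n × ℝ => ((h, q.1), q.2) by
          fun_prop)).aemeasurable
    _ = ∫⁻ h : Rn n, ∫⁻ θ in Set.Ioo (0 : ℝ) 1, ENNReal.ofReal (θ ^ c) *
          (ENNReal.ofReal (‖h‖ ^ (a + 1 - n)) * G (θ * ‖h‖)) := by
        refine lintegral_congr fun h => lintegral_congr fun θ => ?_
        simp only [hΦ]
        rw [lintegral_const_mul _ (by fun_prop), lintegral_const_mul _ (by fun_prop),
          lintegral_add_right_eq_self (fun x => g (x, θ * ‖h‖))]
    _ = ∫⁻ θ in Set.Ioo (0 : ℝ) 1, ENNReal.ofReal (θ ^ c) *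
          ∫⁻ h : Rn n, ENNReal.ofReal (‖h‖ ^ (a + 1 - n)) * G (θ * ‖h‖) := by
        rw [lintegral_lintegral_swap (by fun_prop)]
        exact lintegral_congr fun θ => lintegral_const_mul _ (by fun_prop)
    _ ≤ ∫⁻ θ in Set.Ioo (0 : ℝ) 1, ENNReal.ofReal (θ ^ (c - (a + 1))) *
          (C₂ * ∫⁻ t : ℝ, ENNReal.ofReal (|t| ^ a) * G t) := by
        refine setLIntegral_mono' measurableSet_Ioo fun θ hθ => ?_
        refine (mul_le_mul_right (h₂ G hGm θ hθ.1) _).trans (le_of_eq ?_)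
        have : θ ^ (c - (a + 1)) = θ ^ c * θ ^ (-(a + 1)) := by
          rw [← Real.rpow_add hθ.1]; congr 1
        rw [this, ENNReal.ofReal_mul (Real.rpow_nonneg hθ.1.le _)]
        ring
    _ = C₂ * C₃ * ∫⁻ t : ℝ, ENNReal.ofReal (|t| ^ a) * G t := by
        rw [lintegral_mul_const _ (by fun_prop)]
        ring

/-- The trace inequality, for the half of a path from `(x, 0)` to `(x + h, 0)` that joins
`(x, 0)` to the elevated midpoint `(x + h / 2, |h|)`. -/
theorem exists_lintegral_midpoint_le (hn : 1 ≤ n) {p s : ℝ} (hp : 1 < p) (hs0 : 0 < s) :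
    ∃ C : ℝ≥0∞, C ≠ ⊤ ∧ ∀ v : RnR n → ℝ, ContDiff ℝ 1 v →
      ∫⁻ h : Rn n, ∫⁻ x : Rn n,
          ‖v (mkPt x 0) - v (mkPt (x + (1 / 2 : ℝ) • h) ‖h‖)‖ₑ ^ p * besovKernel n p s h ≤
        C * ∫⁻ z, ‖fderiv ℝ v z‖ₑ ^ p ∂(weightedMeasure n (p * (1 - s) - 1)) := by
  have hp1 : 0 < p - 1 := by linarith
  have hp0 : 0 < p := by linarith
  have hsp : 0 < s * p := by positivity
  -- any exponent strictly between `1 - s - 1 / p` and `1 - 1 / p` would do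
  set b := 1 - 1 / p - s / 2 with hb
  have hbq : b * (p / (p - 1)) < 1 := by
    have : b * (p / (p - 1)) = 1 - s * p / (2 * (p - 1)) := by
      rw [hb]; field_simp
    rw [this]
    have : 0 < s * p / (2 * (p - 1)) := by positivity
    linarith
  have hbp : b * p = p - 1 - s * p / 2 := by rw [hb]; field_simp
  obtain ⟨C₁, hC₁, h₁⟩ := exists_midpoint_increment_le (n := n) (s := s) hp hbq
  obtain ⟨C₂, hC₂, h₂⟩ := exists_lintegral_segments_le hn
    (show p * (1 - s) - 1 < b * p by rw [hbp]; linarith)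
  refine ⟨C₁ * C₂, by finiteness, fun v hv => ?_⟩
  have hDm : Measurable fun z => ‖fderiv ℝ v z‖ₑ ^ p :=
    (hv.continuous_fderiv (by simp)).enorm.measurable.pow_const p
  rw [lintegral_weightedMeasure hDm, mul_assoc]
  refine le_trans ?_ (mul_le_mul_right (h₂ _ (hDm.comp measurable_mkPt)) _)
  simp only [sub_add_cancel, Function.comp_def]
  rw [← lintegral_const_mul' _ _ hC₁]
  refine lintegral_mono fun h => ?_
  dsimp only
  rw [← lintegral_const_mul' _ _ hC₁]
  exact lintegral_mono fun x => h₁ v hv h x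

/-- The trace inequality: the Besov energy of the restriction of `v` to `ℝⁿ × {0}` is controlled
by the weighted energy of `v`. -/
theorem exists_besovEnergy_trace_le (hn : 1 ≤ n) {p s : ℝ} (hp : 1 < p) (hs0 : 0 < s) :
    ∃ C : ℝ≥0∞, C ≠ ⊤ ∧ ∀ v : RnR n → ℝ, ContDiff ℝ 1 v →
      besovEnergy p s (fun x => v (mkPt x 0)) ≤
        C * ∫⁻ z, ‖fderiv ℝ v z‖ₑ ^ p ∂(weightedMeasure n (p * (1 - s) - 1)) := by
  obtain ⟨C, hC, h⟩ := exists_lintegral_midpoint_le hn hp hs0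
  have hp0 : 0 ≤ p := by linarith
  refine ⟨2 ^ (p - 1) * 2 * C, by have := sub_pos.2 hp; finiteness, fun v hv => ?_⟩
  set A : Rn n → Rn n → ℝ≥0∞ := fun x y =>
    ‖v (mkPt x 0) - v (mkPt ((1 / 2 : ℝ) • (x + y)) ‖x - y‖)‖ₑ ^ p with hA
  have hAm : Measurable fun q : Rn n × Rn n => A q.1 q.2 := by
    have h1 : Continuous fun q : Rn n × Rn n => v (mkPt q.1 0) :=
      hv.continuous.comp (continuous_mkPt.comp (by fun_prop :
        Continuous fun q : Rn n × Rn n => (q.1, (0 : ℝ))))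
    have h2 : Continuous fun q : Rn n × Rn n => v (mkPt ((1 / 2 : ℝ) • (q.1 + q.2)) ‖q.1 - q.2‖) :=
      hv.continuous.comp (continuous_mkPt.comp (by fun_prop :
        Continuous fun q : Rn n × Rn n => ((1 / 2 : ℝ) • (q.1 + q.2), ‖q.1 - q.2‖)))
    exact (h1.sub h2).enorm.measurable.pow_const p
  have hk := measurable_besovKernel (n := n) p s
  have hAm' : Measurable fun q : Rn n × Rn n => A q.2 q.1 := hAm.comp measurable_swap
  have hpt : ∀ y x : Rn n, ‖v (mkPt x 0) - v (mkPt y 0)‖ₑ ^ p * besovKernel n p s (x - y) ≤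
      2 ^ (p - 1) * (A x y * besovKernel n p s (x - y) + A y x * besovKernel n p s (y - x)) := by
    intro y x
    rw [← besovKernel_neg p s (y - x), neg_sub, ← add_mul, ← mul_assoc]
    gcongr
    refine le_trans (ENNReal.rpow_le_rpow ?_ hp0) (ENNReal.rpow_add_le_mul_rpow_add_rpow _ _ hp.le)
    rw [norm_sub_rev y x, add_comm y x]
    refine le_trans (le_of_eq ?_) (enorm_sub_le (E := ℝ))
    congr 1; ring
  have hI : ∫⁻ y, ∫⁻ x, A y x * besovKernel n p s (y - x) ≤
      C * ∫⁻ z, ‖fderiv ℝ v z‖ₑ ^ p ∂(weightedMeasure n (p * (1 - s) - 1)) := by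
    have e1 : ∀ y, ∫⁻ x, A y x * besovKernel n p s (y - x) =
        ∫⁻ h, ‖v (mkPt y 0) - v (mkPt (y + (1 / 2 : ℝ) • h) ‖h‖)‖ₑ ^ p *
          besovKernel n p s h := by
      intro y
      rw [← lintegral_add_left_eq_self (fun x => A y x * besovKernel n p s (y - x)) y]
      refine lintegral_congr fun h => ?_
      simp only [hA, sub_add_cancel_left, norm_neg, besovKernel_neg]
      congr 6
      module
    rw [lintegral_congr e1, lintegral_lintegral_swap]
    · exact h v hv
    · have := (hAm.comp (show Measurable fun q : Rn n × Rn n => (q.1, q.1 + q.2) by fun_prop)).mul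
        (hk.comp measurable_snd)
      refine this.aemeasurable.congr (Filter.Eventually.of_forall fun q => ?_)
      simp only [hA, Function.comp, Function.uncurry, Pi.mul_apply, sub_add_cancel_left, norm_neg]
      congr 6
      module
  calc besovEnergy p s (fun x => v (mkPt x 0))
      ≤ ∫⁻ y, ∫⁻ x, 2 ^ (p - 1) * (A x y * besovKernel n p s (x - y) +
          A y x * besovKernel n p s (y - x)) := by
        rw [besovEnergy_eq hp0]
        exact lintegral_mono fun y => lintegral_mono fun x => hpt y x
    _ = 2 ^ (p - 1) * ((∫⁻ y, ∫⁻ x, A x y * besovKernel n p s (x - y)) +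
          ∫⁻ y, ∫⁻ x, A y x * besovKernel n p s (y - x)) := by
        rw [← lintegral_add_left (by fun_prop), ← lintegral_const_mul _ (by fun_prop)]
        refine lintegral_congr fun y => ?_
        rw [lintegral_const_mul _ (by fun_prop), lintegral_add_left (by fun_prop)]
    _ = 2 ^ (p - 1) * (2 * ∫⁻ y, ∫⁻ x, A y x * besovKernel n p s (y - x)) := by
        rw [lintegral_lintegral_swap (by fun_prop), two_mul]
    _ ≤ 2 ^ (p - 1) * (2 * (C * _)) := by gcongr
    _ = _ := by ring

/-! ### Extension by mollification -/

/-- The extension `V(x, t) = ∫ u(x - t y) φ(y) dy` of `u : ℝⁿ → ℝ` to `ℝⁿ⁺¹`. For `t ≠ 0` it is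
the convolution of `u` with the dilate `|t|⁻ⁿ φ(· / t)`; the formula makes sense, and is smooth,
across `t = 0`. -/
noncomputable def mollifierExtension (u φ : Rn n → ℝ) (z : RnR n) : ℝ :=
  ∫ y, u (z.fst - z.snd • y) * φ y

theorem mollifierExtension_mkPt (u φ : Rn n → ℝ) (x : Rn n) (t : ℝ) :
    mollifierExtension u φ (mkPt x t) = ∫ y, u (x - t • y) * φ y := rfl

theorem contDiff_withLp_fst : ContDiff ℝ ∞ fun z : RnR n => z.fst :=
  (WithLp.fstL 2 ℝ (Rn n) ℝ).contDiff

theorem contDiff_withLp_snd : ContDiff ℝ ∞ fun z : RnR n => z.snd :=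
  (WithLp.sndL 2 ℝ (Rn n) ℝ).contDiff

theorem contDiff_mollifierExtension {u φ : Rn n → ℝ} (hu : ContDiff ℝ ∞ u) (hφ : ContDiff ℝ ∞ φ)
    (hφc : HasCompactSupport φ) : ContDiff ℝ ∞ (mollifierExtension u φ) := by
  -- the integral is the convolution at `0` of `1` with a compactly supported function
  -- depending smoothly on the parameter `z`
  set g : RnR n → Rn n → ℝ := fun z y => u (z.fst + z.snd • y) * φ (-y) with hg
  have hgs : ContDiff ℝ ∞ (Function.uncurry g) := by
    have h1 : ContDiff ℝ ∞ fun q : RnR n × Rn n => q.1.fst := contDiff_withLp_fst.comp contDiff_fst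
    have h2 : ContDiff ℝ ∞ fun q : RnR n × Rn n => q.1.snd := contDiff_withLp_snd.comp contDiff_fst
    exact (hu.comp (h1.add (h2.smul contDiff_snd))).mul
      (hφ.comp contDiff_snd.neg)
  have h := contDiffOn_convolution_right_with_param_comp (μ := (volume : Measure (Rn n)))
    (n := ⊤) (ContinuousLinearMap.mul ℝ ℝ) (s := Set.univ) (v := fun _ : RnR n => (0 : Rn n))
    contDiffOn_const (f := fun _ => (1 : ℝ)) (g := g) (k := -tsupport φ)
    isOpen_univ hφc.isCompact.neg (fun z y _ hy => by
      have : φ (-y) = 0 := image_eq_zero_of_notMem_tsupport (by simpa using hy)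
      simp [hg, this]) (locallyIntegrable_const _) hgs.contDiffOn
  have h' := contDiffOn_univ.1 h
  convert h' using 1
  funext z
  simp [convolution, mollifierExtension, hg, sub_eq_add_neg]

theorem exists_bound_of_hasCompactSupport {V W : Type*} [TopologicalSpace V]
    [NormedAddCommGroup W] {f : V → W} (hf : Continuous f) (hc : HasCompactSupport f) :
    ∃ M : ℝ, 0 ≤ M ∧ ∀ x, ‖f x‖ ≤ M := by
  obtain ⟨M, hM⟩ := hf.bounded_above_of_compact_support hc
  exact ⟨max M 0, le_max_right _ _, fun x => (hM x).trans (le_max_left _ _)⟩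

theorem hasDerivAt_add_smul_sub_smul {V : Type*} [NormedAddCommGroup V] [NormedSpace ℝ V]
    (a b y : V) (c d τ : ℝ) :
    HasDerivAt (fun τ : ℝ => (a + τ • b) - (c + τ * d) • y) (b - d • y) τ := by
  have h : HasDerivAt (fun τ : ℝ => c + τ * d) d τ := by
    simpa using ((hasDerivAt_id τ).mul_const d).const_add c
  exact (hasDerivAt_add_smul_const a b τ).sub (h.smul_const y)

theorem fderiv_mollifierExtension_apply {u φ : Rn n → ℝ} (hu : ContDiff ℝ ∞ u)
    (huc : HasCompactSupport u) (hφ : ContDiff ℝ ∞ φ) (hφc : HasCompactSupport φ)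
    (z ξ : RnR n) :
    fderiv ℝ (mollifierExtension u φ) z ξ =
      ∫ y, fderiv ℝ u (z.fst - z.snd • y) (ξ.fst - ξ.snd • y) * φ y := by
  have hu' : Continuous (fderiv ℝ u) := hu.continuous_fderiv (by simp)
  obtain ⟨M, hM0, hM⟩ := exists_bound_of_hasCompactSupport hu' (huc.fderiv ℝ)
  have hφi : Continuous φ := hφ.continuous
  have huC : Continuous u := hu.continuous
  have h1 : HasDerivAt (fun τ : ℝ => mollifierExtension u φ (z + τ • ξ))
      (fderiv ℝ (mollifierExtension u φ) z ξ) 0 := by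
    exact ((contDiff_mollifierExtension hu hφ hφc).differentiable
      (by simp) z).hasFDerivAt.comp_hasDerivAt_of_eq 0
        (hasDerivAt_add_smul_const z ξ 0) (by rw [zero_smul, add_zero])
  have h2 := hasDerivAt_integral_of_dominated_loc_of_deriv_le (μ := (volume : Measure (Rn n)))
    (F := fun (τ : ℝ) (y : Rn n) =>
      u ((z.fst + τ • ξ.fst) - (z.snd + τ * ξ.snd) • y) * φ y)
    (F' := fun (τ : ℝ) (y : Rn n) =>
      fderiv ℝ u ((z.fst + τ • ξ.fst) - (z.snd + τ * ξ.snd) • y) (ξ.fst - ξ.snd • y) * φ y)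
    (x₀ := (0 : ℝ)) (s := Set.univ)
    (bound := fun y => M * ‖ξ.fst - ξ.snd • y‖ * ‖φ y‖) Filter.univ_mem
    (Filter.Eventually.of_forall fun τ => by
      have : Continuous fun y => u ((z.fst + τ • ξ.fst) - (z.snd + τ * ξ.snd) • y) * φ y := by
        fun_prop
      exact this.aestronglyMeasurable)
    (by
      refine Continuous.integrable_of_hasCompactSupport (by fun_prop) ?_
      exact hφc.mul_left)
    (by
      have : Continuous fun y => fderiv ℝ u ((z.fst + (0 : ℝ) • ξ.fst) -
          (z.snd + 0 * ξ.snd) • y) (ξ.fst - ξ.snd • y) * φ y := by fun_prop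
      exact this.aestronglyMeasurable)
    (Filter.Eventually.of_forall fun y τ _ => by
      rw [norm_mul]
      gcongr
      exact (ContinuousLinearMap.le_opNorm _ _).trans (by gcongr; exact hM _))
    (Continuous.integrable_of_hasCompactSupport (by fun_prop) hφc.norm.mul_left)
    (Filter.Eventually.of_forall fun y τ _ =>
      ((hu.differentiable (by simp) _).hasFDerivAt.comp_hasDerivAt τ
        (hasDerivAt_add_smul_sub_smul z.fst ξ.fst y z.snd ξ.snd τ)).mul_const _)
  have h3 := h1.unique (h2.2.congr_of_eventuallyEq (Filter.Eventually.of_forall fun τ => by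
    simp [mollifierExtension]))
  rw [h3]
  simp

theorem hasFDerivAt_comp_sub_smul {V : Type*} [NormedAddCommGroup V] [NormedSpace ℝ V]
    {u : V → ℝ} (hu : Differentiable ℝ u) (x y : V) (t : ℝ) :
    HasFDerivAt (fun y => u (x - t • y) - u x) (-(t • fderiv ℝ u (x - t • y))) y := by
  have e1 : HasFDerivAt (fun y : V => x - t • y) (-(t • ContinuousLinearMap.id ℝ V)) y :=
    ((hasFDerivAt_id y).const_smul t).const_sub x
  refine (((hu (x - t • y)).hasFDerivAt.comp y e1).sub_const (u x)).congr_fderiv ?_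
  ext; simp

/-- Integrating by parts moves the derivative of `u` onto `ψ`, at the price of a factor `t⁻¹`; the
constant `u x` may be subtracted because `∫ ∂ψ = 0`. -/
theorem integral_fderiv_comp_mul {u ψ : Rn n → ℝ} (hu : ContDiff ℝ ∞ u)
    (hψ : ContDiff ℝ ∞ ψ) (hψc : HasCompactSupport ψ)
    (x e : Rn n) {t : ℝ} (ht : t ≠ 0) :
    ∫ y, fderiv ℝ u (x - t • y) e * ψ y =
      t⁻¹ * ∫ y, (u (x - t • y) - u x) * fderiv ℝ ψ y e := by
  have hu' : Continuous (fderiv ℝ u) := hu.continuous_fderiv (by simp)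
  have huC : Continuous u := hu.continuous
  have hψ' : Continuous (fderiv ℝ ψ) := hψ.continuous_fderiv (by simp)
  have hψC : Continuous ψ := hψ.continuous
  have hfd : ∀ y, HasFDerivAt (fun y => u (x - t • y) - u x)
      (-(t • fderiv ℝ u (x - t • y))) y := by
    intro y
    exact hasFDerivAt_comp_sub_smul (hu.differentiable (by simp)) x y t
  have hfe : ∀ y, fderiv ℝ (fun y => u (x - t • y) - u x) y e =
      -(t * fderiv ℝ u (x - t • y) e) := fun y => by rw [(hfd y).fderiv]; simp
  have h := integral_mul_fderiv_eq_neg_fderiv_mul_of_integrable (μ := (volume : Measure (Rn n)))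
    (f := fun y => u (x - t • y) - u x) (g := ψ) (v := e)
    (by
      simp only [hfe]
      exact Continuous.integrable_of_hasCompactSupport (by fun_prop) hψc.mul_left)
    (Continuous.integrable_of_hasCompactSupport (by fun_prop)
      ((hψc.fderiv_apply ℝ e).mul_left))
    (Continuous.integrable_of_hasCompactSupport (by fun_prop) hψc.mul_left)
    (fun y _ => (hfd y).differentiableAt) (fun y _ => hψ.differentiable (by simp) y)
  rw [h]
  simp only [hfe, neg_mul, integral_neg, neg_neg, mul_assoc, integral_const_mul]
  rw [inv_mul_cancel_left₀ ht]

/-- The gradient of the extension at height `t` is controlled by the mean oscillation of `u` at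
scale `|t|`. -/
theorem exists_norm_fderiv_mollifierExtension_le {φ : Rn n → ℝ} (hφ : ContDiff ℝ ∞ φ)
    (hφs : tsupport φ ⊆ closedBall 0 1) :
    ∃ M : ℝ, 0 ≤ M ∧ ∀ u : Rn n → ℝ, ContDiff ℝ ∞ u → HasCompactSupport u →
      ∀ (x : Rn n) (t : ℝ), t ≠ 0 →
        ‖fderiv ℝ (mollifierExtension u φ) (mkPt x t)‖ ≤
          |t|⁻¹ * M * ∫ y in closedBall 0 1, |u (x - t • y) - u x| := by
  have hφc : HasCompactSupport φ :=
    (isCompact_closedBall (0 : Rn n) 1).of_isClosed_subset (isClosed_tsupport φ) hφs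
  obtain ⟨M₀, hM₀, h₀⟩ := exists_bound_of_hasCompactSupport hφ.continuous hφc
  obtain ⟨M₁, hM₁, h₁⟩ := exists_bound_of_hasCompactSupport
    (hφ.continuous_fderiv (by simp)) (hφc.fderiv ℝ)
  refine ⟨n * (2 * M₁ + M₀), by positivity, fun u hu huc x t ht => ?_⟩
  have huC : Continuous u := hu.continuous
  have hI : 0 ≤ ∫ y in closedBall (0 : Rn n) 1, |u (x - t • y) - u x| :=
    integral_nonneg fun _ => abs_nonneg _
  refine ContinuousLinearMap.opNorm_le_bound _ (by positivity) fun ξ => ?_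
  set e : Fin n → Rn n := fun i => EuclideanSpace.single i 1 with he
  -- the components of the vector field `y ↦ (ξ_x - ξ_t y) φ(y)`
  set ψ : Fin n → Rn n → ℝ := fun i y => (ξ.fst i - ξ.snd * y i) * φ y with hψ
  have hlin : ∀ i, ContDiff ℝ ∞ fun y : Rn n => y i := fun i =>
    (EuclideanSpace.proj (𝕜 := ℝ) i).contDiff
  have hψs : ∀ i, ContDiff ℝ ∞ (ψ i) := fun i =>
    (contDiff_const.sub (contDiff_const.mul (hlin i))).mul hφ
  have hψc : ∀ i, HasCompactSupport (ψ i) := fun i => hφc.mul_left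
  have hu' : Continuous (fderiv ℝ u) := hu.continuous_fderiv (by simp)
  have hsum : fderiv ℝ (mollifierExtension u φ) (mkPt x t) ξ =
      t⁻¹ * ∫ y, (u (x - t • y) - u x) * ∑ i, fderiv ℝ (ψ i) y (e i) := by
    rw [fderiv_mollifierExtension_apply hu huc hφ hφc]
    have e1 : ∀ y, fderiv ℝ u ((mkPt x t).fst - (mkPt x t).snd • y) (ξ.fst - ξ.snd • y) * φ y =
        ∑ i, fderiv ℝ u (x - t • y) (e i) * ψ i y := by
      intro y
      have : ξ.fst - ξ.snd • y = ∑ i, (ξ.fst i - ξ.snd * y i) • e i := by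
        ext j
        simp [he, Finset.sum_apply, Pi.single_apply]
      rw [this, map_sum, Finset.sum_mul]
      refine Finset.sum_congr rfl fun i _ => ?_
      rw [map_smul, smul_eq_mul, hψ]
      change _ * fderiv ℝ u (x - t • y) (e i) * φ y = _
      ring
    simp only [e1, Finset.mul_sum]
    rw [integral_finsetSum _ fun i _ => ?_, integral_finsetSum _ fun i _ => ?_, Finset.mul_sum]
    · exact Finset.sum_congr rfl fun i _ =>
        integral_fderiv_comp_mul hu (hψs i) (hψc i) x (e i) ht
    · have := (hψs i).continuous_fderiv (by simp)
      exact Continuous.integrable_of_hasCompactSupport (by fun_prop)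
        (((hψc i).fderiv_apply ℝ (e i)).mul_left)
    · have := (hψs i).continuous
      exact Continuous.integrable_of_hasCompactSupport (by fun_prop) (hψc i).mul_left
  have hfst : ‖ξ.fst‖ ≤ ‖ξ‖ := WithLp.norm_fst_le (p := 2) (x := ξ)
  have hsnd : |ξ.snd| ≤ ‖ξ‖ := WithLp.norm_snd_le (p := 2) (x := ξ)
  have hdiv : ∀ y ∈ closedBall (0 : Rn n) 1,
      |∑ i, fderiv ℝ (ψ i) y (e i)| ≤ n * (2 * M₁ + M₀) * ‖ξ‖ := by
    intro y hy
    have hy1 : ‖y‖ ≤ 1 := by simpa using hy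
    have : ∀ i ∈ Finset.univ, |fderiv ℝ (ψ i) y (e i)| ≤ (2 * M₁ + M₀) * ‖ξ‖ := by
      intro i _
      have e1 : HasFDerivAt (fun y : Rn n => ξ.fst i - ξ.snd * y i)
          (-(ξ.snd • (EuclideanSpace.proj i : Rn n →L[ℝ] ℝ))) y :=
        (((EuclideanSpace.proj i : Rn n →L[ℝ] ℝ).hasFDerivAt).const_mul ξ.snd).const_sub _
      have e2 := (e1.mul (hφ.differentiable (by simp) y).hasFDerivAt).fderiv
      have e3 : fderiv ℝ (ψ i) y (e i) =
          (ξ.fst i - ξ.snd * y i) * fderiv ℝ φ y (e i) - φ y * ξ.snd := by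
        change fderiv ℝ ((fun y : Rn n => ξ.fst i - ξ.snd * y i) * φ) y (e i) = _
        rw [e2]
        simp [he, sub_eq_add_neg]
      have hei : ‖e i‖ = 1 := by simp [he]
      have b1 : |ξ.fst i| ≤ ‖ξ‖ := (PiLp.norm_apply_le ξ.fst i).trans hfst
      have b2 : |y i| ≤ 1 := (PiLp.norm_apply_le y i).trans hy1
      have b3 : |fderiv ℝ φ y (e i)| ≤ M₁ := by
        refine ((fderiv ℝ φ y).le_opNorm (e i)).trans ?_
        rw [hei, mul_one]; exact h₁ y
      have b4 : |φ y| ≤ M₀ := h₀ y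
      rw [e3]
      calc |(ξ.fst i - ξ.snd * y i) * fderiv ℝ φ y (e i) - φ y * ξ.snd|
          ≤ (|ξ.fst i| + |ξ.snd| * |y i|) * |fderiv ℝ φ y (e i)| + |φ y| * |ξ.snd| := by
            refine (abs_sub _ _).trans ?_
            rw [abs_mul, abs_mul, ← abs_mul ξ.snd]
            gcongr
            exact abs_sub _ _
        _ ≤ (‖ξ‖ + ‖ξ‖ * 1) * M₁ + M₀ * ‖ξ‖ := by gcongr
        _ = _ := by ring
    refine (Finset.abs_sum_le_sum_abs _ _).trans ((Finset.sum_le_sum this).trans ?_)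
    simp [mul_assoc]
  have hout : ∀ y ∉ closedBall (0 : Rn n) 1, ∑ i, fderiv ℝ (ψ i) y (e i) = 0 := by
    intro y hy
    refine Finset.sum_eq_zero fun i _ => ?_
    have : y ∉ tsupport (ψ i) := fun h => hy (hφs (tsupport_mul_subset_right h))
    rw [image_eq_zero_of_notMem_tsupport fun h => this (tsupport_fderiv_subset ℝ h)]
    rfl
  rw [hsum, ← setIntegral_eq_integral_of_forall_compl_eq_zero (s := closedBall (0 : Rn n) 1)
    (fun y hy => by rw [hout y hy, mul_zero]), norm_mul, norm_inv, Real.norm_eq_abs]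
  rw [mul_assoc, mul_assoc, mul_assoc]
  refine mul_le_mul_of_nonneg_left ?_ (by positivity)
  refine (norm_integral_le_of_norm_le (g := fun y => |u (x - t • y) - u x| *
    (n * (2 * M₁ + M₀) * ‖ξ‖)) ?_ ?_).trans (le_of_eq ?_)
  · exact (Continuous.continuousOn (by fun_prop)).integrableOn_compact (isCompact_closedBall _ _)
  · filter_upwards [ae_restrict_mem measurableSet_closedBall] with y hy
    rw [norm_mul, Real.norm_eq_abs, Real.norm_eq_abs]
    exact mul_le_mul_of_nonneg_left (hdiv y hy) (abs_nonneg _)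
  · rw [integral_mul_const]; ring

/-! ### Energy estimates for the extension -/

/-- The tail integral behind the extension estimate: the heights `|t| ≥ |h|` contribute a multiple
of the Besov kernel at `h`. -/
theorem lintegral_indicator_abs_rpow (hn : 1 ≤ n) {p s : ℝ} (hsp : 0 < s * p) {h : Rn n}
    (h0 : h ≠ 0) :
    ∫⁻ t : ℝ, (if ‖h‖ ≤ |t| then 1 else 0) * ENNReal.ofReal (|t| ^ (-(n + s * p) - 1)) =
      2 * ENNReal.ofReal ((n + s * p)⁻¹) * besovKernel n p s h := by
  have hh : 0 < ‖h‖ := norm_pos_iff.2 h0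
  have hn' : (1 : ℝ) ≤ n := by exact_mod_cast hn
  have hm : Measurable fun t : ℝ => (if ‖h‖ ≤ t then (1 : ℝ≥0∞) else 0) *
      ENNReal.ofReal (t ^ (-(n + s * p) - 1)) :=
    (Measurable.ite measurableSet_Ici measurable_const measurable_const).mul (by fun_prop)
  rw [lintegral_fun_abs hm, mul_assoc]
  congr 1
  have e1 : ∀ t : ℝ, (if ‖h‖ ≤ t then (1 : ℝ≥0∞) else 0) *
      ENNReal.ofReal (t ^ (-(n + s * p) - 1)) =
      (Set.Ici ‖h‖).indicator (fun t => ENNReal.ofReal (t ^ (-(n + s * p) - 1))) t := by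
    intro t
    by_cases ht : ‖h‖ ≤ t <;> simp [ht]
  simp only [e1]
  rw [setLIntegral_indicator measurableSet_Ici, Set.inter_eq_left.2 (Set.Ici_subset_Ioi.2 hh),
    setLIntegral_congr Ioi_ae_eq_Ici.symm, setLIntegral_Ioi_rpow (by linarith) hh, besovKernel,
    ← ENNReal.ofReal_mul (by positivity)]
  congr 1
  rw [sub_add_cancel, neg_div_neg_eq]
  field_simp

/-- The substitution `h = t y` followed by an exchange of the integrals in `t` and `h`. The
hypothesis `H 0 = 0` is needed because the kernel takes the value `0` at `h = 0`. -/
theorem exists_lintegral_ball_dilate_le (hn : 1 ≤ n) {p s : ℝ} (hsp : 0 < s * p) :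
    ∃ C : ℝ≥0∞, C ≠ ⊤ ∧ ∀ H : Rn n → ℝ≥0∞, Measurable H → H 0 = 0 →
      ∫⁻ t : ℝ, ENNReal.ofReal (|t| ^ (-(s * p) - 1)) *
          ∫⁻ y in closedBall (0 : Rn n) 1, H (t • y) ≤
        C * ∫⁻ h, H h * besovKernel n p s h := by
  refine ⟨2 * ENNReal.ofReal ((n + s * p)⁻¹), by finiteness, fun H hH hH0 => ?_⟩
  have hmi : Measurable fun q : ℝ × Rn n => if ‖q.2‖ ≤ |q.1| then (1 : ℝ≥0∞) else 0 :=
    Measurable.ite (measurableSet_le (by fun_prop) (by fun_prop)) measurable_const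
      measurable_const
  have hdil : ∀ t : ℝ, t ≠ 0 → ENNReal.ofReal (|t| ^ (-(s * p) - 1)) *
      ∫⁻ y in closedBall (0 : Rn n) 1, H (t • y) =
      ∫⁻ h, ((if ‖h‖ ≤ |t| then 1 else 0) * ENNReal.ofReal (|t| ^ (-(n + s * p) - 1))) * H h := by
    intro t ht
    have ht' : 0 < |t| := abs_pos.2 ht
    have e1 : ∫⁻ y in closedBall (0 : Rn n) 1, H (t • y) =
        ∫⁻ y, (if ‖t • y‖ ≤ |t| then 1 else 0) * H (t • y) := by
      rw [← lintegral_indicator measurableSet_closedBall]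
      refine lintegral_congr fun y => ?_
      have : ‖t • y‖ ≤ |t| ↔ y ∈ closedBall (0 : Rn n) 1 := by
        rw [norm_smul, Real.norm_eq_abs, mem_closedBall_zero_iff]
        exact mul_le_iff_le_one_right ht'
      by_cases hy : y ∈ closedBall (0 : Rn n) 1 <;> simp [this, hy]
    have hm : Measurable fun h : Rn n => (if ‖h‖ ≤ |t| then (1 : ℝ≥0∞) else 0) * H h :=
      (hmi.comp (measurable_prodMk_left (x := t))).mul hH
    rw [e1, lintegral_comp_smul_addHaar volume hm ht, ← mul_assoc,
      ← ENNReal.ofReal_mul (by positivity), finrank_euclideanSpace_fin,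
      ← lintegral_const_mul _ hm]
    refine lintegral_congr fun h => ?_
    have : |t| ^ (-(s * p) - 1) * |(t ^ n)⁻¹| = |t| ^ (-(n + s * p) - 1) := by
      rw [abs_inv, abs_pow, ← Real.rpow_natCast, ← Real.rpow_neg ht'.le, ← Real.rpow_add ht']
      congr 1; ring
    rw [this]; ring
  calc ∫⁻ t : ℝ, ENNReal.ofReal (|t| ^ (-(s * p) - 1)) *
          ∫⁻ y in closedBall (0 : Rn n) 1, H (t • y)
      = ∫⁻ t : ℝ, ∫⁻ h, ((if ‖h‖ ≤ |t| then 1 else 0) *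
          ENNReal.ofReal (|t| ^ (-(n + s * p) - 1))) * H h := by
        refine lintegral_congr_ae ?_
        filter_upwards [Measure.ae_ne volume (0 : ℝ)] with t ht using hdil t ht
    _ = ∫⁻ h, ∫⁻ t : ℝ, ((if ‖h‖ ≤ |t| then 1 else 0) *
          ENNReal.ofReal (|t| ^ (-(n + s * p) - 1))) * H h := by
        refine lintegral_lintegral_swap (Measurable.aemeasurable ?_)
        exact (hmi.mul (by fun_prop)).mul (hH.comp measurable_snd)
    _ ≤ ∫⁻ h, 2 * ENNReal.ofReal ((n + s * p)⁻¹) * (H h * besovKernel n p s h) := by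
        refine lintegral_mono fun h => ?_
        rcases eq_or_ne h 0 with rfl | h0
        · simp [hH0]
        · rw [lintegral_mul_const, lintegral_indicator_abs_rpow hn hsp h0]
          · apply le_of_eq; ring
          · exact (hmi.comp (measurable_prodMk_right (y := h))).mul (by fun_prop)
    _ = _ := lintegral_const_mul _ (hH.mul (measurable_besovKernel p s))

/-- The extension inequality: the weighted energy of the extension of `u` is controlled by the
Besov energy of `u`. -/
theorem exists_lintegral_fderiv_mollifierExtension_le (hn : 1 ≤ n) {p s : ℝ} (hp : 1 < p)
    (hs0 : 0 < s) {φ : Rn n → ℝ} (hφ : ContDiff ℝ ∞ φ) (hφs : tsupport φ ⊆ closedBall 0 1) :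
    ∃ C : ℝ≥0∞, C ≠ ⊤ ∧ ∀ u : Rn n → ℝ, ContDiff ℝ ∞ u → HasCompactSupport u →
      ∫⁻ z, ‖fderiv ℝ (mollifierExtension u φ) z‖ₑ ^ p ∂(weightedMeasure n (p * (1 - s) - 1)) ≤
        C * besovEnergy p s u := by
  have hp0 : 0 < p := by linarith
  have hφc : HasCompactSupport φ :=
    (isCompact_closedBall (0 : Rn n) 1).of_isClosed_subset (isClosed_tsupport φ) hφs
  obtain ⟨M, hM0, hM⟩ := exists_norm_fderiv_mollifierExtension_le hφ hφs
  obtain ⟨C, hC, h⟩ := exists_lintegral_ball_dilate_le hn (show 0 < s * p by positivity)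
  set B := closedBall (0 : Rn n) 1 with hB
  set K : ℝ≥0∞ := ENNReal.ofReal (M ^ p) * volume B ^ (p - 1) with hK
  have hBt : volume B ≠ ⊤ := measure_closedBall_lt_top.ne
  have hKt : K ≠ ⊤ := by
    have : 0 ≤ p - 1 := by linarith
    finiteness
  refine ⟨K * C, by finiteness, fun u hu huc => ?_⟩
  have huC : Continuous u := hu.continuous
  have hVm : Measurable fun z => ‖fderiv ℝ (mollifierExtension u φ) z‖ₑ ^ p :=
    ((contDiff_mollifierExtension hu hφ hφc).continuous_fderiv
      (by simp)).enorm.measurable.pow_const p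
  set H : Rn n → ℝ≥0∞ := fun h => ∫⁻ x, ‖u (x - h) - u x‖ₑ ^ p with hH
  have hum : Measurable fun q : Rn n × Rn n => ‖u (q.2 - q.1) - u q.2‖ₑ ^ p :=
    (Continuous.enorm (by fun_prop)).measurable.pow_const p
  have hHm : Measurable H := hum.lintegral_prod_right'
  have hpt : ∀ t : ℝ, t ≠ 0 → ∀ x, ‖fderiv ℝ (mollifierExtension u φ) (mkPt x t)‖ₑ ^ p ≤
      ENNReal.ofReal (|t| ^ (-p)) * K * ∫⁻ y in B, ‖u (x - t • y) - u x‖ₑ ^ p := by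
    intro t ht x
    have e1 : ‖fderiv ℝ (mollifierExtension u φ) (mkPt x t)‖ₑ ≤
        ENNReal.ofReal (|t|⁻¹ * M) * ∫⁻ y in B, ‖u (x - t • y) - u x‖ₑ := by
      rw [← ofReal_norm]
      refine (ENNReal.ofReal_le_ofReal (hM u hu huc x t ht)).trans (le_of_eq ?_)
      rw [ENNReal.ofReal_mul (by positivity), ofReal_integral_eq_lintegral_ofReal]
      · simp only [← Real.norm_eq_abs, ofReal_norm]
      · exact (Continuous.continuousOn (by fun_prop)).integrableOn_compact
          (isCompact_closedBall _ _)
      · exact Filter.Eventually.of_forall fun _ => abs_nonneg _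
    calc ‖fderiv ℝ (mollifierExtension u φ) (mkPt x t)‖ₑ ^ p
        ≤ ENNReal.ofReal ((|t|⁻¹ * M) ^ p) * (∫⁻ y in B, ‖u (x - t • y) - u x‖ₑ) ^ p := by
          rw [← ENNReal.ofReal_rpow_of_nonneg (by positivity) hp0.le,
            ← ENNReal.mul_rpow_of_nonneg _ _ hp0.le]
          exact ENNReal.rpow_le_rpow e1 hp0.le
      _ ≤ ENNReal.ofReal ((|t|⁻¹ * M) ^ p) *
            (volume B ^ (p - 1) * ∫⁻ y in B, ‖u (x - t • y) - u x‖ₑ ^ p) := by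
          gcongr
          exact setLIntegral_rpow_le volume hp B
            (Continuous.enorm (by fun_prop)).measurable.aemeasurable
      _ = _ := by
          rw [Real.mul_rpow (by positivity) hM0, Real.inv_rpow (abs_nonneg _),
            ← Real.rpow_neg (abs_nonneg _), ENNReal.ofReal_mul (by positivity), hK]
          ring
  have hslice : ∀ t : ℝ, t ≠ 0 → ENNReal.ofReal (|t| ^ (p * (1 - s) - 1)) *
      ∫⁻ x, ‖fderiv ℝ (mollifierExtension u φ) (mkPt x t)‖ₑ ^ p ≤
      K * (ENNReal.ofReal (|t| ^ (-(s * p) - 1)) * ∫⁻ y in B, H (t • y)) := by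
    intro t ht
    have ht' : 0 < |t| := abs_pos.2 ht
    have hm : Measurable fun q : Rn n × Rn n => ‖u (q.1 - t • q.2) - u q.1‖ₑ ^ p :=
      (Continuous.enorm (by fun_prop)).measurable.pow_const p
    calc _ ≤ ENNReal.ofReal (|t| ^ (p * (1 - s) - 1)) * ∫⁻ x, ENNReal.ofReal (|t| ^ (-p)) * K *
            ∫⁻ y in B, ‖u (x - t • y) - u x‖ₑ ^ p := by
          gcongr with x
          exact hpt t ht x
      _ = ENNReal.ofReal (|t| ^ (p * (1 - s) - 1)) * (ENNReal.ofReal (|t| ^ (-p)) * K *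
            ∫⁻ y in B, H (t • y)) := by
          rw [lintegral_const_mul _ hm.lintegral_prod_right',
            lintegral_lintegral_swap hm.aemeasurable]
      _ = _ := by
          have : |t| ^ (-(s * p) - 1) = |t| ^ (p * (1 - s) - 1) * |t| ^ (-p) := by
            rw [← Real.rpow_add ht']; congr 1; ring
          rw [this, ENNReal.ofReal_mul (by positivity)]
          ring
  calc _ = ∫⁻ t, ENNReal.ofReal (|t| ^ (p * (1 - s) - 1)) *
          ∫⁻ x, ‖fderiv ℝ (mollifierExtension u φ) (mkPt x t)‖ₑ ^ p :=
        lintegral_weightedMeasure hVm _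
    _ ≤ ∫⁻ t : ℝ, K * (ENNReal.ofReal (|t| ^ (-(s * p) - 1)) * ∫⁻ y in B, H (t • y)) := by
        refine lintegral_mono_ae ?_
        filter_upwards [Measure.ae_ne volume (0 : ℝ)] with t ht using hslice t ht
    _ = K * ∫⁻ t : ℝ, ENNReal.ofReal (|t| ^ (-(s * p) - 1)) * ∫⁻ y in B, H (t • y) :=
        lintegral_const_mul' _ _ hKt
    _ ≤ K * (C * ∫⁻ h, H h * besovKernel n p s h) := by
        gcongr
        exact h H hHm (by simp [hH, ENNReal.zero_rpow_of_pos hp0])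
    _ = K * C * besovEnergy p s u := by
        rw [besovEnergy_eq_increments hp0.le huC.measurable]
        exact (mul_assoc _ _ _).symm

/-- On each slice `t = const`, the extension is bounded on `Lᵖ`. -/
theorem exists_lintegral_mollifierExtension_slice_le {p : ℝ} (hp : 1 < p) {φ : Rn n → ℝ}
    (hφ : Continuous φ) (hφs : tsupport φ ⊆ closedBall 0 1) :
    ∃ C : ℝ≥0∞, C ≠ ⊤ ∧ ∀ u : Rn n → ℝ, Continuous u → ∀ t : ℝ,
      ∫⁻ x, ‖mollifierExtension u φ (mkPt x t)‖ₑ ^ p ≤ C * ∫⁻ x, ‖u x‖ₑ ^ p := by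
  have hp0 : 0 < p := by linarith
  have hφc : HasCompactSupport φ :=
    (isCompact_closedBall (0 : Rn n) 1).of_isClosed_subset (isClosed_tsupport φ) hφs
  obtain ⟨M, hM0, hM⟩ := exists_bound_of_hasCompactSupport hφ hφc
  set B := closedBall (0 : Rn n) 1 with hB
  set K : ℝ≥0∞ := ENNReal.ofReal M ^ p * volume B ^ (p - 1) with hK
  have hBt : volume B ≠ ⊤ := measure_closedBall_lt_top.ne
  have hKt : K ≠ ⊤ := by
    have : 0 ≤ p - 1 := by linarith
    finiteness
  refine ⟨K * volume B, by finiteness, fun u hu t => ?_⟩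
  have hpt : ∀ x, ‖mollifierExtension u φ (mkPt x t)‖ₑ ^ p ≤
      K * ∫⁻ y in B, ‖u (x - t • y)‖ₑ ^ p := by
    intro x
    have e1 : ‖mollifierExtension u φ (mkPt x t)‖ₑ ≤
        ENNReal.ofReal M * ∫⁻ y in B, ‖u (x - t • y)‖ₑ := by
      rw [mollifierExtension_mkPt, ← setIntegral_eq_integral_of_forall_compl_eq_zero (s := B)
        (fun y hy => by
          rw [image_eq_zero_of_notMem_tsupport fun h => hy (hφs h), mul_zero])]
      refine (enorm_integral_le_lintegral_enorm _).trans ?_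
      rw [← lintegral_const_mul' _ _ ENNReal.ofReal_ne_top]
      refine lintegral_mono fun y => ?_
      dsimp only
      rw [enorm_mul, mul_comm]
      gcongr
      rw [← ofReal_norm]
      exact ENNReal.ofReal_le_ofReal (hM y)
    calc _ ≤ (ENNReal.ofReal M * ∫⁻ y in B, ‖u (x - t • y)‖ₑ) ^ p :=
          ENNReal.rpow_le_rpow e1 hp0.le
      _ = ENNReal.ofReal M ^ p * (∫⁻ y in B, ‖u (x - t • y)‖ₑ) ^ p :=
          ENNReal.mul_rpow_of_nonneg _ _ hp0.le
      _ ≤ ENNReal.ofReal M ^ p * (volume B ^ (p - 1) * ∫⁻ y in B, ‖u (x - t • y)‖ₑ ^ p) := by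
          gcongr
          exact setLIntegral_rpow_le volume hp B
            (Continuous.enorm (by fun_prop)).measurable.aemeasurable
      _ = _ := by rw [hK]; ring
  have hm : Measurable fun q : Rn n × Rn n => ‖u (q.1 - t • q.2)‖ₑ ^ p :=
    (Continuous.enorm (by fun_prop)).measurable.pow_const p
  calc _ ≤ ∫⁻ x, K * ∫⁻ y in B, ‖u (x - t • y)‖ₑ ^ p := lintegral_mono hpt
    _ = K * ∫⁻ y in B, ∫⁻ x, ‖u (x - t • y)‖ₑ ^ p := by
        rw [lintegral_const_mul' _ _ hKt, lintegral_lintegral_swap hm.aemeasurable]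
    _ = K * volume B * ∫⁻ x, ‖u x‖ₑ ^ p := by
        simp only [lintegral_sub_right_eq_self (fun x => ‖u x‖ₑ ^ p)]
        rw [setLIntegral_const]; ring

theorem exists_setLIntegral_mollifierExtension_le {p a : ℝ} (hp : 1 < p) (ha : -1 < a)
    {φ : Rn n → ℝ} (hφ : ContDiff ℝ ∞ φ) (hφs : tsupport φ ⊆ closedBall 0 1) :
    ∃ C : ℝ≥0∞, C ≠ ⊤ ∧ ∀ u : Rn n → ℝ, ContDiff ℝ ∞ u → ∀ (x₀ : Rn n) (R : ℝ), 0 < R →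
      ∫⁻ z in ball (mkPt x₀ 0) R, ‖mollifierExtension u φ z‖ₑ ^ p ∂(weightedMeasure n a) ≤
        C * ENNReal.ofReal (R ^ (a + 1)) * ∫⁻ x, ‖u x‖ₑ ^ p := by
  have hφc : HasCompactSupport φ :=
    (isCompact_closedBall (0 : Rn n) 1).of_isClosed_subset (isClosed_tsupport φ) hφs
  obtain ⟨C, hC, h⟩ := exists_lintegral_mollifierExtension_slice_le hp hφ.continuous hφs
  refine ⟨2 * ENNReal.ofReal ((a + 1)⁻¹) * C, by finiteness, fun u hu x₀ R hR => ?_⟩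
  have hVm : Measurable fun z => ‖mollifierExtension u φ z‖ₑ ^ p :=
    (contDiff_mollifierExtension hu hφ hφc).continuous.enorm.measurable.pow_const p
  set S : Set ℝ := Set.Iio R with hS
  have hSm : Measurable fun t : ℝ => S.indicator (fun _ => (1 : ℝ≥0∞)) t :=
    measurable_const.indicator measurableSet_Iio
  have hsnd : Measurable fun z : RnR n => z.snd := contDiff_withLp_snd.continuous.measurable
  have hFm : Measurable fun z : RnR n =>
      S.indicator (fun _ => (1 : ℝ≥0∞)) |z.snd| * ‖mollifierExtension u φ z‖ₑ ^ p :=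
    (hSm.comp hsnd.abs).mul hVm
  calc _ ≤ ∫⁻ z, S.indicator (fun _ => (1 : ℝ≥0∞)) |z.snd| *
          ‖mollifierExtension u φ z‖ₑ ^ p ∂(weightedMeasure n a) := by
        rw [← lintegral_indicator measurableSet_ball]
        refine lintegral_mono fun z => ?_
        by_cases hz : z ∈ ball (mkPt x₀ 0) R
        · have : |z.snd| < R := by
            have h1 := WithLp.norm_snd_le (p := 2) (x := z - mkPt x₀ 0)
            rw [mem_ball_iff_norm] at hz
            have h2 : (z - mkPt x₀ 0).snd = z.snd := sub_zero _
            rw [h2] at h1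
            exact h1.trans_lt hz
          simp [hz, hS, this]
        · simp [hz]
    _ = ∫⁻ t, ENNReal.ofReal (|t| ^ a) * ∫⁻ x, S.indicator (fun _ => (1 : ℝ≥0∞)) |t| *
          ‖mollifierExtension u φ (mkPt x t)‖ₑ ^ p := lintegral_weightedMeasure hFm a
    _ ≤ ∫⁻ t, (ENNReal.ofReal (|t| ^ a) * S.indicator (fun _ => (1 : ℝ≥0∞)) |t|) *
          (C * ∫⁻ x, ‖u x‖ₑ ^ p) := by
        refine lintegral_mono fun t => ?_
        dsimp only
        rw [lintegral_const_mul _ (f := fun x => ‖mollifierExtension u φ (mkPt x t)‖ₑ ^ p)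
          (hVm.comp (measurable_mkPt.comp measurable_prodMk_right)),
          mul_assoc]
        gcongr
        exact h u hu.continuous t
    _ = (∫⁻ t : ℝ, ENNReal.ofReal (|t| ^ a) * S.indicator (fun _ => (1 : ℝ≥0∞)) |t|) *
          (C * ∫⁻ x, ‖u x‖ₑ ^ p) := lintegral_mul_const _ (by fun_prop)
    _ = (2 * ENNReal.ofReal (R ^ (a + 1) / (a + 1))) * (C * ∫⁻ x, ‖u x‖ₑ ^ p) := by
        congr 1
        rw [lintegral_fun_abs (f := fun t => ENNReal.ofReal (t ^ a) *
          S.indicator (fun _ => (1 : ℝ≥0∞)) t) (by fun_prop), ← setLIntegral_Ioo_rpow ha hR]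
        congr 1
        have : ∀ t : ℝ, ENNReal.ofReal (t ^ a) * S.indicator (fun _ => (1 : ℝ≥0∞)) t =
            S.indicator (fun t => ENNReal.ofReal (t ^ a)) t := by
          intro t
          by_cases ht : t ∈ S <;> simp [ht]
        simp only [this]
        rw [setLIntegral_indicator measurableSet_Iio, Set.Iio_inter_Ioi]
    _ = _ := by
        rw [div_eq_mul_inv, ENNReal.ofReal_mul (by positivity)]; ring

/-! ### A Poincaré inequality -/

/-- A Poincaré inequality: for `u` supported in a ball of radius `2 r`, comparing the values of `u`
with its value `0` on a neighbouring ball of radius `r` bounds the `Lᵖ` norm by the Besov energy. -/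
theorem exists_lintegral_rpow_le_besovEnergy (hn : 1 ≤ n) {p s : ℝ} (hp : 1 < p) (hs0 : 0 < s) :
    ∃ C : ℝ≥0∞, C ≠ ⊤ ∧ ∀ (x₀ : Rn n) (r : ℝ), 0 < r → ∀ u : Rn n → ℝ, Measurable u →
      (∀ x ∉ ball x₀ (2 * r), u x = 0) →
      ∫⁻ x, ‖u x‖ₑ ^ p ≤ C * ENNReal.ofReal (r ^ (s * p)) * besovEnergy p s u := by
  have hp0 : 0 < p := by linarith
  have : NeZero n := ⟨by omega⟩
  have : Nontrivial (Rn n) := inferInstance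
  obtain ⟨e, he⟩ := exists_norm_eq (Rn n) (zero_le_one)
  have hb0 : volume (ball (0 : Rn n) 1) ≠ 0 := (measure_ball_pos _ _ one_pos).ne'
  have hbt : volume (ball (0 : Rn n) 1) ≠ ⊤ := measure_ball_lt_top.ne
  set α : ℝ := n + s * p with hα
  have hα0 : 0 < α := by positivity
  refine ⟨ENNReal.ofReal (7 ^ α) * (volume (ball (0 : Rn n) 1))⁻¹, by finiteness,
    fun x₀ r hr u hu hsupp => ?_⟩
  set A := ball (x₀ + (4 * r) • e) r with hA
  have hAvol : volume A = ENNReal.ofReal (r ^ n) * volume (ball (0 : Rn n) 1) := by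
    rw [hA, Measure.addHaar_ball _ _ hr.le, finrank_euclideanSpace_fin]
  have hpt : ∀ x, ∀ y ∈ A, ‖u x‖ₑ ^ p ≤
      ENNReal.ofReal ((7 * r) ^ α) * (‖u x - u y‖ₑ ^ p * besovKernel n p s (x - y)) := by
    intro x y hy
    by_cases hx : x ∈ ball x₀ (2 * r)
    · rw [mem_ball_iff_norm] at hx hy
      have h4 : ‖(4 * r) • e‖ = 4 * r := by
        rw [norm_smul, he, Real.norm_of_nonneg (by positivity), mul_one]
      have hy0 : u y = 0 := by
        apply hsupp
        rw [mem_ball_iff_norm, not_lt]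
        have : ‖(4 * r) • e‖ ≤ ‖y - x₀‖ + ‖y - (x₀ + (4 * r) • e)‖ := by
          refine le_trans (le_of_eq ?_) (norm_sub_le _ _)
          congr 1; abel
        linarith
      have hxy : ‖x - y‖ ≤ 7 * r := by
        have : ‖x - y‖ ≤ ‖x - x₀‖ + ‖y - (x₀ + (4 * r) • e)‖ + ‖(4 * r) • e‖ := by
          refine le_trans (le_of_eq ?_) ((norm_sub_le _ _).trans
            (add_le_add_left (norm_sub_le _ _) _))
          congr 1; abel
        linarith
      rcases eq_or_ne x y with rfl | hne
      · rw [hy0, enorm_zero, ENNReal.zero_rpow_of_pos hp0]; exact zero_le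
      · have hpos : 0 < ‖x - y‖ := norm_pos_iff.2 (sub_ne_zero.2 hne)
        rw [hy0, sub_zero, mul_left_comm, besovKernel, ← ENNReal.ofReal_mul (by positivity)]
        refine le_mul_of_one_le_right' ?_
        rw [ENNReal.one_le_ofReal, Real.rpow_neg hpos.le, ← div_eq_mul_inv,
          one_le_div (by positivity)]
        exact Real.rpow_le_rpow hpos.le hxy hα0.le
    · rw [hsupp x hx, enorm_zero, ENNReal.zero_rpow_of_pos hp0]; exact zero_le
  have hk := measurable_besovKernel (n := n) p s
  have key : volume A * ∫⁻ x, ‖u x‖ₑ ^ p ≤ ENNReal.ofReal ((7 * r) ^ α) * besovEnergy p s u := by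
    calc volume A * ∫⁻ x, ‖u x‖ₑ ^ p = ∫⁻ y in A, ∫⁻ x, ‖u x‖ₑ ^ p := by
          rw [setLIntegral_const, mul_comm]
      _ ≤ ∫⁻ y in A, ∫⁻ x, ENNReal.ofReal ((7 * r) ^ α) *
            (‖u x - u y‖ₑ ^ p * besovKernel n p s (x - y)) :=
          setLIntegral_mono' measurableSet_ball fun y hy => lintegral_mono fun x => hpt x y hy
      _ ≤ ∫⁻ y, ∫⁻ x, ENNReal.ofReal ((7 * r) ^ α) *
            (‖u x - u y‖ₑ ^ p * besovKernel n p s (x - y)) := setLIntegral_le_lintegral _ _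
      _ = _ := by
          simp only [lintegral_const_mul' _ _ ENNReal.ofReal_ne_top]
          rw [besovEnergy_eq hp0.le]
  have hA0 : volume A ≠ 0 := (measure_ball_pos _ _ hr).ne'
  have hAt : volume A ≠ ⊤ := measure_ball_lt_top.ne
  rw [mul_comm, ← ENNReal.le_div_iff_mul_le (Or.inl hA0) (Or.inl hAt)] at key
  refine key.trans (le_of_eq ?_)
  have hr7 : (7 * r) ^ α = 7 ^ α * r ^ (s * p) * r ^ n := by
    rw [Real.mul_rpow (by norm_num) hr.le, mul_assoc, ← Real.rpow_natCast r n,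
      ← Real.rpow_add hr, hα, add_comm (s * p)]
  have hrn : ENNReal.ofReal (r ^ n) ≠ 0 := by
    rw [Ne, ENNReal.ofReal_eq_zero, not_le]; positivity
  rw [hAvol, hr7, ENNReal.ofReal_mul (by positivity), ENNReal.ofReal_mul (by positivity),
    ENNReal.div_eq_inv_mul, ENNReal.mul_inv (Or.inl hrn) (Or.inl ENNReal.ofReal_ne_top)]
  calc _ = ((ENNReal.ofReal (r ^ n))⁻¹ * ENNReal.ofReal (r ^ n)) *
        (ENNReal.ofReal (7 ^ α) * (volume (ball (0 : Rn n) 1))⁻¹ *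
          ENNReal.ofReal (r ^ (s * p)) * besovEnergy p s u) := by ring
    _ = _ := by rw [ENNReal.inv_mul_cancel hrn ENNReal.ofReal_ne_top, one_mul]

/-! ### Restriction of test functions -/

theorem norm_mkPt_zero_sub (x y : Rn n) : ‖mkPt x 0 - mkPt y 0‖ = ‖x - y‖ := by
  have h1 : (mkPt x 0 - mkPt y 0).fst = x - y := rfl
  have h2 : (mkPt x 0 - mkPt y 0).snd = 0 := sub_zero _
  rw [WithLp.prod_norm_eq_of_L2, h1, h2]
  simp

theorem contDiff_mkPt_zero : ContDiff ℝ ∞ fun x : Rn n => mkPt x 0 := by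
  have h : ContDiff ℝ ∞ fun x : Rn n => (x, (0 : ℝ)) := by fun_prop
  exact (WithLp.prodContinuousLinearEquiv 2 ℝ (Rn n) ℝ).symm.contDiff.comp h

theorem IsTestFunctionOn.comp_mkPt_zero {v : RnR n → ℝ} {x₀ : Rn n} {R : ℝ}
    (hv : IsTestFunctionOn v (ball (mkPt x₀ 0) R)) :
    IsTestFunctionOn (fun x => v (mkPt x 0)) (ball x₀ R) := by
  have hs : tsupport (fun x => v (mkPt x 0)) ⊆ ball x₀ R := by
    intro x hx
    have := hv.tsupport_subset
      (tsupport_comp_subset_preimage v contDiff_mkPt_zero.continuous hx)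
    rwa [mem_ball_iff_norm, norm_mkPt_zero_sub, ← mem_ball_iff_norm] at this
  exact ⟨hv.smooth.comp contDiff_mkPt_zero, (isCompact_closedBall x₀ R).of_isClosed_subset
    (isClosed_tsupport _) (hs.trans ball_subset_closedBall), hs⟩

/-- The trace inequality for capacities: the restriction of an admissible function for `K × {0}` is
admissible for `K`. -/
theorem exists_besovCapCompact_le (hn : 1 ≤ n) {p s : ℝ} (hp : 1 < p) (hs0 : 0 < s) :
    ∃ C : ℝ≥0∞, C ≠ ⊤ ∧ ∀ (x₀ : Rn n) (R : ℝ) (K : Set (Rn n)) (v : RnR n → ℝ),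
      IsTestFunctionOn v (ball (mkPt x₀ 0) R) →
      (∀ z ∈ (fun x => mkPt x 0) '' K, 1 ≤ v z) →
      besovCapCompact p s K (ball x₀ R) ≤
        C * ∫⁻ z in ball (mkPt x₀ 0) R, ENNReal.ofReal (‖∇ v z‖ ^ p)
          ∂(weightedMeasure n (p * (1 - s) - 1)) := by
  have hp0 : 0 < p := by linarith
  obtain ⟨C, hC, h⟩ := exists_besovEnergy_trace_le hn hp hs0
  refine ⟨C, hC, fun x₀ R K v hv h1 => ?_⟩
  refine (iInf₂_le (fun x => v (mkPt x 0))
    ⟨hv.comp_mkPt_zero, fun x hx => h1 _ ⟨x, hx, rfl⟩⟩).trans ?_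
  refine (h v (hv.smooth.of_le (by simp))).trans (mul_le_mul_right ?_ _)
  rw [← lintegral_indicator measurableSet_ball]
  refine lintegral_mono fun z => ?_
  by_cases hz : z ∈ ball (mkPt x₀ 0) R
  · simp only [Set.indicator_of_mem hz, ofReal_norm_gradient_rpow v z hp0.le, le_refl]
  · have : fderiv ℝ v z = 0 := image_eq_zero_of_notMem_tsupport
      fun hz' => hz (hv.tsupport_subset (tsupport_fderiv_subset ℝ hz'))
    change ‖fderiv ℝ v z‖ₑ ^ p ≤ _
    rw [this, ← ofReal_norm, norm_zero, ENNReal.ofReal_zero, ENNReal.zero_rpow_of_pos hp0]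
    exact zero_le

/-! ### Extension of test functions -/

theorem enorm_fderiv_mul_le {V : Type*} [NormedAddCommGroup V] [NormedSpace ℝ V] {f g : V → ℝ}
    {z : V} (hf : DifferentiableAt ℝ f z) (hg : DifferentiableAt ℝ g z) :
    ‖fderiv ℝ (fun z => f z * g z) z‖ₑ ≤
      ‖f z‖ₑ * ‖fderiv ℝ g z‖ₑ + ‖g z‖ₑ * ‖fderiv ℝ f z‖ₑ := by
  have := (hf.hasFDerivAt.mul hg.hasFDerivAt).fderiv
  change fderiv ℝ (fun z => f z * g z) z = _ at this
  rw [this]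
  exact (enorm_add_le (E := V →L[ℝ] ℝ) _ _).trans_eq (by rw [enorm_smul, enorm_smul])

/-- Smooth cutoff functions between the balls of radius `r` and `3 r / 2`, with gradient at most
`M / r` where `M` does not depend on the scale `r`. -/
theorem exists_scaled_cutoff {V : Type*} [NormedAddCommGroup V] [InnerProductSpace ℝ V]
    [FiniteDimensional ℝ V] :
    ∃ M : ℝ, 0 ≤ M ∧ ∀ (z₀ : V) (r : ℝ), 0 < r → ∃ η : V → ℝ, ContDiff ℝ ∞ η ∧
      (∀ z, ‖η z‖ₑ ≤ 1) ∧ (∀ z, ‖fderiv ℝ η z‖ₑ ≤ ENNReal.ofReal (M / r)) ∧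
      (∀ z ∈ closedBall z₀ r, η z = 1) ∧ tsupport η ⊆ closedBall z₀ (3 / 2 * r) := by
  let η₀ : ContDiffBump (0 : V) := ⟨1, 3 / 2, by norm_num, by norm_num⟩
  obtain ⟨M, hM0, hM⟩ := exists_bound_of_hasCompactSupport
    ((η₀.contDiff (n := ⊤)).continuous_fderiv (by simp)) (η₀.hasCompactSupport.fderiv ℝ)
  refine ⟨M, hM0, fun z₀ r hr => ?_⟩
  let η : V → ℝ := fun z => η₀ (r⁻¹ • (z - z₀))
  have hηs : ContDiff ℝ ∞ η :=
    η₀.contDiff.comp ((contDiff_id.sub contDiff_const).const_smul r⁻¹)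
  have hη1 : ∀ z, ‖η z‖ₑ ≤ 1 := by
    intro z
    rw [← ofReal_norm, Real.norm_of_nonneg η₀.nonneg, ← ENNReal.ofReal_one]
    exact ENNReal.ofReal_le_ofReal η₀.le_one
  have hηd : ∀ z, ‖fderiv ℝ η z‖ₑ ≤ ENNReal.ofReal (M / r) := by
    intro z
    have e1 : HasFDerivAt (fun z : V => r⁻¹ • (z - z₀))
        (r⁻¹ • ContinuousLinearMap.id ℝ (V)) z :=
      ((hasFDerivAt_id z).sub_const _).const_smul r⁻¹
    have e2 := ((η₀.contDiff (n := ⊤)).differentiable (by simp)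
      (r⁻¹ • (z - z₀))).hasFDerivAt.comp z e1
    have e3 : fderiv ℝ η z = r⁻¹ • fderiv ℝ η₀ (r⁻¹ • (z - z₀)) := by
      refine e2.fderiv.trans ?_
      ext; simp
    rw [e3, ← ofReal_norm, norm_smul, norm_inv, Real.norm_of_nonneg hr.le, div_eq_inv_mul]
    exact ENNReal.ofReal_le_ofReal (mul_le_mul_of_nonneg_left (hM _) (by positivity))
  have hηsupp : tsupport η ⊆ closedBall (z₀) (3 / 2 * r) := by
    refine closure_minimal (fun z hz => ?_) isClosed_closedBall
    have : r⁻¹ • (z - z₀) ∈ ball (0 : V) (3 / 2) := by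
      have : r⁻¹ • (z - z₀) ∈ Function.support η₀ := hz
      rwa [η₀.support_eq] at this
    rw [mem_ball_zero_iff, norm_smul, norm_inv, Real.norm_of_nonneg hr.le,
      inv_mul_lt_iff₀ hr] at this
    rw [mem_closedBall_iff_norm]
    linarith
  refine ⟨η, hηs, hη1, hηd, fun z hz => η₀.one_of_mem_closedBall ?_, hηsupp⟩
  rw [mem_closedBall_zero_iff, norm_smul, norm_inv, Real.norm_of_nonneg hr.le,
    inv_mul_le_iff₀ hr]
  rw [mem_closedBall_iff_norm] at hz
  change _ ≤ r * 1
  linarith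

/-- Every test function `u` on `B(x₀, 2 r)` is the trace, on the smaller ball, of a test function
on `B(z₀, 2 r)` whose weighted energy is controlled by the Besov energy of `u`. -/
theorem exists_testFunction_extension (hn : 1 ≤ n) {p s : ℝ} (hp : 1 < p) (hs0 : 0 < s)
    (hs1 : s < 1) :
    ∃ C : ℝ≥0∞, C ≠ ⊤ ∧ ∀ (x₀ : Rn n) (r : ℝ), 0 < r → ∀ u : Rn n → ℝ,
      IsTestFunctionOn u (ball x₀ (2 * r)) →
      ∃ w : RnR n → ℝ, IsTestFunctionOn w (ball (mkPt x₀ 0) (2 * r)) ∧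
        (∀ x ∈ closedBall x₀ r, w (mkPt x 0) = u x) ∧
        ∫⁻ z in ball (mkPt x₀ 0) (2 * r), ENNReal.ofReal (‖∇ w z‖ ^ p)
          ∂(weightedMeasure n (p * (1 - s) - 1)) ≤ C * besovEnergy p s u := by
  have hp0 : 0 < p := by linarith
  have hp1 : 0 ≤ p - 1 := by linarith
  have ha : -1 < p * (1 - s) - 1 := by
    have : 0 < p * (1 - s) := mul_pos hp0 (by linarith)
    linarith
  let φ₀ : ContDiffBump (0 : Rn n) := ⟨1 / 2, 1, by norm_num, by norm_num⟩
  set φ : Rn n → ℝ := φ₀.normed volume with hφdef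
  have hφ : ContDiff ℝ ∞ φ := φ₀.contDiff_normed
  have hφs : tsupport φ ⊆ closedBall 0 1 := (φ₀.tsupport_normed_eq).subset
  have hφc : HasCompactSupport φ := φ₀.hasCompactSupport_normed
  obtain ⟨C₁, hC₁, h₁⟩ := exists_lintegral_fderiv_mollifierExtension_le hn hp hs0 hφ hφs
  obtain ⟨C₂, hC₂, h₂⟩ := exists_setLIntegral_mollifierExtension_le hp ha hφ hφs
  obtain ⟨C₃, hC₃, h₃⟩ := exists_lintegral_rpow_le_besovEnergy hn hp hs0
  obtain ⟨M, hM0, hM⟩ := exists_scaled_cutoff (V := RnR n)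
  refine ⟨2 ^ (p - 1) * (C₁ + ENNReal.ofReal (M ^ p * 2 ^ (p * (1 - s))) * (C₂ * C₃)),
    by finiteness, fun x₀ r hr u hu => ?_⟩
  set V := mollifierExtension u φ with hV
  have hVs : ContDiff ℝ ∞ V := contDiff_mollifierExtension hu.smooth hφ hφc
  obtain ⟨η, hηs, hη1, hηd, hηone, hηsupp⟩ := hM (mkPt x₀ 0) r hr
  have hwsupp : tsupport (fun z => η z * V z) ⊆ closedBall (mkPt x₀ 0) (3 / 2 * r) :=
    tsupport_mul_subset_left.trans hηsupp
  refine ⟨fun z => η z * V z, ⟨hηs.mul hVs, ?_, ?_⟩, fun x hx => ?_, ?_⟩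
  · exact (isCompact_closedBall _ _).of_isClosed_subset (isClosed_tsupport _) hwsupp
  · exact hwsupp.trans (closedBall_subset_ball (by linarith))
  · have e1 : η (mkPt x 0) = 1 := hηone _ (by
      rwa [mem_closedBall_iff_norm, norm_mkPt_zero_sub, ← mem_closedBall_iff_norm])
    have e2 : V (mkPt x 0) = u x := by
      rw [hV, mollifierExtension_mkPt]
      simp only [zero_smul, sub_zero]
      rw [integral_const_mul, hφdef, φ₀.integral_normed, mul_one]
    change η (mkPt x 0) * V (mkPt x 0) = u x
    rw [e1, e2, one_mul]
  · set μ := weightedMeasure n (p * (1 - s) - 1) with hμ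
    have hVm : Measurable fun z => ‖fderiv ℝ V z‖ₑ ^ p :=
      (hVs.continuous_fderiv (by simp)).enorm.measurable.pow_const p
    have hpt : ∀ z, ENNReal.ofReal (‖∇ (fun z => η z * V z) z‖ ^ p) ≤
        2 ^ (p - 1) * (‖fderiv ℝ V z‖ₑ ^ p + ENNReal.ofReal (M / r) ^ p * ‖V z‖ₑ ^ p) := by
      intro z
      rw [ofReal_norm_gradient_rpow _ _ hp0.le, ← ENNReal.mul_rpow_of_nonneg _ _ hp0.le]
      refine (ENNReal.rpow_le_rpow ?_ hp0.le).trans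
        (ENNReal.rpow_add_le_mul_rpow_add_rpow _ _ hp.le)
      refine (enorm_fderiv_mul_le (hηs.differentiable (by simp) z)
        (hVs.differentiable (by simp) z)).trans (add_le_add ?_ ?_)
      · exact (mul_le_mul_left (hη1 z) _).trans (one_mul _).le
      · rw [mul_comm]; exact mul_le_mul_left (hηd z) _
    have hu0 : ∀ x ∉ ball x₀ (2 * r), u x = 0 := fun x hx =>
      image_eq_zero_of_notMem_tsupport fun h => hx (hu.tsupport_subset h)
    have hscale : ENNReal.ofReal (M / r) ^ p * (ENNReal.ofReal ((2 * r) ^ (p * (1 - s))) *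
        ENNReal.ofReal (r ^ (s * p))) = ENNReal.ofReal (M ^ p * 2 ^ (p * (1 - s))) := by
      rw [ENNReal.ofReal_rpow_of_nonneg (by positivity) hp0.le,
        ← ENNReal.ofReal_mul (by positivity), ← ENNReal.ofReal_mul (by positivity),
        Real.div_rpow hM0 hr.le, Real.mul_rpow (by norm_num) hr.le]
      have : r ^ p = r ^ (p * (1 - s)) * r ^ (s * p) := by
        rw [← Real.rpow_add hr]; congr 1; ring
      have hrp : 0 < r ^ p := Real.rpow_pos_of_pos hr _
      congr 1
      rw [mul_assoc, ← this]
      field_simp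
    calc _ ≤ ∫⁻ z in ball (mkPt x₀ 0) (2 * r), 2 ^ (p - 1) * (‖fderiv ℝ V z‖ₑ ^ p +
            ENNReal.ofReal (M / r) ^ p * ‖V z‖ₑ ^ p) ∂μ := lintegral_mono hpt
      _ = 2 ^ (p - 1) * ((∫⁻ z in ball (mkPt x₀ 0) (2 * r), ‖fderiv ℝ V z‖ₑ ^ p ∂μ) +
            ENNReal.ofReal (M / r) ^ p *
              ∫⁻ z in ball (mkPt x₀ 0) (2 * r), ‖V z‖ₑ ^ p ∂μ) := by
          rw [lintegral_const_mul' _ _ (by finiteness), lintegral_add_left hVm,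
            lintegral_const_mul' _ _ (by finiteness)]
      _ ≤ 2 ^ (p - 1) * (C₁ * besovEnergy p s u + ENNReal.ofReal (M / r) ^ p *
            (C₂ * ENNReal.ofReal ((2 * r) ^ (p * (1 - s))) *
              (C₃ * ENNReal.ofReal (r ^ (s * p)) * besovEnergy p s u))) := by
          gcongr
          · exact (setLIntegral_le_lintegral _ _).trans (h₁ u hu.smooth hu.hasCompactSupport)
          · have := h₂ u hu.smooth x₀ (2 * r) (by positivity)
            rw [sub_add_cancel] at this
            refine this.trans ?_
            gcongr
            exact h₃ x₀ r hr u hu.smooth.continuous.measurable hu0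
      _ = 2 ^ (p - 1) * (C₁ + (ENNReal.ofReal (M / r) ^ p *
            (ENNReal.ofReal ((2 * r) ^ (p * (1 - s))) * ENNReal.ofReal (r ^ (s * p)))) *
              (C₂ * C₃)) * besovEnergy p s u := by ring
      _ = _ := by rw [hscale]

/-- The extension inequality for capacities. The cutoff equals one above `K` because `K` lies in
the concentric ball of radius `r`. -/
theorem exists_weightedCapCompact_le (hn : 1 ≤ n) {p s : ℝ} (hp : 1 < p) (hs0 : 0 < s)
    (hs1 : s < 1) :
    ∃ C : ℝ≥0∞, C ≠ ⊤ ∧ ∀ (x₀ : Rn n) (r : ℝ), 0 < r → ∀ K ⊆ closedBall x₀ r,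
      ∀ u : Rn n → ℝ, IsTestFunctionOn u (ball x₀ (2 * r)) → (∀ x ∈ K, 1 ≤ u x) →
      weightedCapCompact p (p * (1 - s) - 1) ((fun x => mkPt x 0) '' K)
        (ball (mkPt x₀ 0) (2 * r)) ≤ C * besovEnergy p s u := by
  obtain ⟨C, hC, h⟩ := exists_testFunction_extension hn hp hs0 hs1
  refine ⟨C, hC, fun x₀ r hr K hK u hu hu1 => ?_⟩
  obtain ⟨w, hw, hwu, hwE⟩ := h x₀ r hr u hu
  refine (iInf₂_le w ⟨hw, ?_⟩).trans hwE
  rintro _ ⟨x, hx, rfl⟩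
  rw [hwu x (hK hx)]
  exact hu1 x hx

end

theorem lemma1p3 (n : ℕ) (hn : 1 ≤ n) (p s : ℝ) (hp : 1 < p) (hs0 : 0 < s) (hs1 : s < 1) :
    ∃ C : ℝ, 0 < C ∧
      ∀ (x₀ : Rn n) (r : ℝ), 0 < r →
      ∀ E : Set (Rn n), MeasurableSet E → E ⊆ closedBall x₀ r →
        besovCap p s E (ball x₀ (2 * r)) ≤
          ENNReal.ofReal C *
            weightedCap p (p * (1 - s) - 1) ((fun x => mkPt x 0) '' E)
              (ball (mkPt x₀ 0) (2 * r)) ∧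
        weightedCap p (p * (1 - s) - 1) ((fun x => mkPt x 0) '' E)
            (ball (mkPt x₀ 0) (2 * r)) ≤
          ENNReal.ofReal C * besovCap p s E (ball x₀ (2 * r)) := by
  obtain ⟨C₁, hC₁, h₁⟩ := exists_besovCapCompact_le hn hp hs0
  obtain ⟨C₂, hC₂, h₂⟩ := exists_weightedCapCompact_le hn hp hs0 hs1
  set C : ℝ := C₁.toReal + C₂.toReal + 1 with hC
  have hCpos : 0 < C := by positivity
  have hC0 : ENNReal.ofReal C ≠ 0 := by simpa using hCpos
  have hCt : ENNReal.ofReal C ≠ ⊤ := ENNReal.ofReal_ne_top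
  have hC₁C : C₁ ≤ ENNReal.ofReal C :=
    ENNReal.le_ofReal_iff_toReal_le hC₁ hCpos.le |>.2 (by
      have : 0 ≤ C₂.toReal := ENNReal.toReal_nonneg
      linarith)
  have hC₂C : C₂ ≤ ENNReal.ofReal C :=
    ENNReal.le_ofReal_iff_toReal_le hC₂ hCpos.le |>.2 (by
      have : 0 ≤ C₁.toReal := ENNReal.toReal_nonneg
      linarith)
  refine ⟨C, hCpos, fun x₀ r hr E _ hE => ⟨?_, ?_⟩⟩
  · refine iSup₂_le fun K hK => ?_
    have hK' : IsCompact ((fun x => mkPt x 0) '' K) ∧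
        (fun x => mkPt x 0) '' K ⊆ (fun x => mkPt x 0) '' E :=
      ⟨hK.1.image contDiff_mkPt_zero.continuous, Set.image_mono hK.2⟩
    refine le_trans ?_ (mul_le_mul_right (le_iSup₂ (f := fun (K : Set (RnR n))
      (_ : IsCompact K ∧ K ⊆ (fun x => mkPt x 0) '' E) =>
        weightedCapCompact p (p * (1 - s) - 1) K (ball (mkPt x₀ 0) (2 * r))) _ hK') _)
    rw [← ENNReal.div_le_iff' hC0 hCt]
    refine le_iInf₂ fun v hv => ?_
    rw [ENNReal.div_le_iff' hC0 hCt]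
    exact (h₁ x₀ (2 * r) K v hv.1 hv.2).trans (mul_le_mul_left hC₁C _)
  · refine iSup₂_le fun K' hK' => ?_
    -- every compact subset of `E × {0}` is of the form `K × {0}`
    set K : Set (Rn n) := (fun z : RnR n => z.fst) '' K' with hKdef
    have hK : IsCompact K ∧ K ⊆ E := by
      refine ⟨hK'.1.image contDiff_withLp_fst.continuous, ?_⟩
      rintro _ ⟨z, hz, rfl⟩
      obtain ⟨x, hx, rfl⟩ := hK'.2 hz
      exact hx
    have hKK : K' = (fun x => mkPt x 0) '' K := by
      rw [hKdef, Set.image_image]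
      refine (Set.image_congr (g := id) fun z hz => ?_).trans (Set.image_id _) |>.symm
      obtain ⟨x, hx, rfl⟩ := hK'.2 hz
      rfl
    refine le_trans ?_ (mul_le_mul_right (le_iSup₂ (f := fun (K : Set (Rn n))
      (_ : IsCompact K ∧ K ⊆ E) => besovCapCompact p s K (ball x₀ (2 * r))) K hK) _)
    rw [← ENNReal.div_le_iff' hC0 hCt]
    refine le_iInf₂ fun u hu => ?_
    rw [ENNReal.div_le_iff' hC0 hCt, hKK]
    exact (h₂ x₀ r hr K (hK.2.trans hE) u hu.1 hu.2).trans (mul_le_mul_left hC₂C _)
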